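/- Let $(M,g)$ be a compact connected smooth Riemannian manifold (without boundary) of dimension $n$, let $T$ be a smooth 3-form on $M$ and let $f:M\to\mathbb R$ be a smooth function. Let $\nabla^g$ be the Levi-Civita connection, $Ric^g$ its Ricci tensor and $Scal^g$ its scalar curvature. Let $\delta$ be the codifferential, $(\delta T)_{ij}=-\nabla^g_sT_{sij}$, and put $T^2_{ij}=\sum_{a,b}T_{iab}T_{jab}$ and $\|T\|^2=\sum_{i,a,b}T_{iab}T_{iab}$, where components are taken in an orthonormal frame. The torsion connection is the metric connection $\nabla=\nabla^g+\frac12T$ with totally skew-symmetric torsion $T$, and $Ric$ denotes its Ricci tensor. Suppose that $(M,g,T,f)$ is a generalized (steady) gradient Ricci soliton, that is, $$Ric^g_{ij}=\tfrac14T^2_{ij}-\nabla^g_i\nabla^g_jf,\qquad (\delta T)_{ij}=-\sum_s (df)_s\,T_{sij},\qquad dT=0.$$ Then the following conditions are equivalent: a) the norm of the torsion is constant, $d\|T\|^2=0$; b) the function $f$ is constant; c) the torsion connection is Ricci flat, $Ric=0$; d) the Riemannian scalar curvature $Scal^g$ is constant. In each of these four cases $T$ is harmonic, that is, $dT=0$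 and $\delta T=0$. -/

import Mathlib

open scoped Manifold ContDiff

noncomputable section

namespace SkewTorsion

/-! ### Ricci calculus in local coordinates

In this part `G : E → Matrix` is the matrix `g_{ij}` of a metric in coordinates, `τ i j k` are the
components of a 3-form, `A k i j` are the coefficients of a connection
(`∇_{∂_i} ∂_j = ∑ k, A k i j ∂_k`) and `u` is a function, all given on the model space `ℝⁿ`.
The inverse matrix `(G y)⁻¹` is `g^{ij}`. -/

section Local

/-- The model space `ℝⁿ`. -/
abbrev Coord (n : ℕ) : Type := EuclideanSpace ℝ (Fin n)

variable {n : ℕ}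

/-- The `i`-th coordinate vector of `ℝⁿ`. -/
def basisVec (i : Fin n) : Coord n := EuclideanSpace.single i 1

/-- The partial derivative `∂_i u`. -/
def pd (i : Fin n) (u : Coord n → ℝ) (y : Coord n) : ℝ := fderiv ℝ u y (basisVec i)

/-- The Christoffel symbols `Γ^k_{ij} = ½ g^{kl} (∂_i g_{jl} + ∂_j g_{il} - ∂_l g_{ij})` of the
Levi-Civita connection. -/
def christoffel (G : Coord n → Matrix (Fin n) (Fin n) ℝ) (k i j : Fin n) (y : Coord n) : ℝ :=
  (1 / 2) * ∑ l, (G y)⁻¹ k l *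
    (pd i (fun z => G z j l) y + pd j (fun z => G z i l) y - pd l (fun z => G z i j) y)

/-- The coefficients `Γ^k_{ij} + ½ g^{kl} T_{ijl}` of the metric connection with skew torsion `T`,
that is of `∇ = ∇^g + ½ T`. -/
def torsionCoeff (G : Coord n → Matrix (Fin n) (Fin n) ℝ)
    (τ : Fin n → Fin n → Fin n → Coord n → ℝ) (k i j : Fin n) (y : Coord n) : ℝ :=
  christoffel G k i j y + (1 / 2) * ∑ l, (G y)⁻¹ k l * τ i j l y

/-- The curvature `R(X,Y)Z = [∇_X, ∇_Y] Z - ∇_{[X,Y]} Z` of the connection with coefficients `A`: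
`curvature A l i j k` is the `∂_l`-component of `R(∂_i, ∂_j) ∂_k`. -/
def curvature (A : Fin n → Fin n → Fin n → Coord n → ℝ) (l i j k : Fin n) (y : Coord n) : ℝ :=
  pd i (A l j k) y - pd j (A l i k) y
    + ∑ m, (A l i m y * A m j k y - A l j m y * A m i k y)

/-- The Ricci tensor of a connection: `Ric(Y, Z)` is the trace of `X ↦ R(X, Y) Z`. -/
def ricci (A : Fin n → Fin n → Fin n → Coord n → ℝ) (j k : Fin n) (y : Coord n) : ℝ :=
  ∑ i, curvature A i i j k y

/-- The scalar curvature `g^{ij} Ric^g_{ij}` of the Levi-Civita connection. -/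
def scalarCurvature (G : Coord n → Matrix (Fin n) (Fin n) ℝ) (y : Coord n) : ℝ :=
  ∑ i, ∑ j, (G y)⁻¹ i j * ricci (christoffel G) i j y

/-- The Hessian `∇^g_i ∇^g_j u = ∂_i ∂_j u - Γ^k_{ij} ∂_k u`. -/
def hessian (G : Coord n → Matrix (Fin n) (Fin n) ℝ) (u : Coord n → ℝ) (i j : Fin n)
    (y : Coord n) : ℝ :=
  pd i (pd j u) y - ∑ k, christoffel G k i j y * pd k u y

/-- `T²_{ij} = T_{iab} T_{jab}`, with indices contracted by the metric. -/
def torsionSq (G : Coord n → Matrix (Fin n) (Fin n) ℝ)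
    (τ : Fin n → Fin n → Fin n → Coord n → ℝ) (i j : Fin n) (y : Coord n) : ℝ :=
  ∑ a, ∑ b, ∑ c, ∑ d, (G y)⁻¹ a c * (G y)⁻¹ b d * τ i a b y * τ j c d y

/-- `‖T‖² = T_{iab} T_{iab}`, with indices contracted by the metric. -/
def normSq (G : Coord n → Matrix (Fin n) (Fin n) ℝ)
    (τ : Fin n → Fin n → Fin n → Coord n → ℝ) (y : Coord n) : ℝ :=
  ∑ i, ∑ j, (G y)⁻¹ i j * torsionSq G τ i j y

/-- The Levi-Civita derivative `(∇^g_{∂_s} T)(∂_a, ∂_i, ∂_j)`. -/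
def covDeriv (G : Coord n → Matrix (Fin n) (Fin n) ℝ)
    (τ : Fin n → Fin n → Fin n → Coord n → ℝ) (s a i j : Fin n) (y : Coord n) : ℝ :=
  pd s (τ a i j) y - ∑ m, (christoffel G m s a y * τ m i j y
    + christoffel G m s i y * τ a m j y + christoffel G m s j y * τ a i m y)

/-- The codifferential of a 3-form, `(δT)_{ij} = - g^{sa} ∇^g_s T_{aij}`. -/
def codiff (G : Coord n → Matrix (Fin n) (Fin n) ℝ)
    (τ : Fin n → Fin n → Fin n → Coord n → ℝ) (i j : Fin n) (y : Coord n) : ℝ :=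
  - ∑ s, ∑ a, (G y)⁻¹ s a * covDeriv G τ s a i j y

/-- The interior product `(grad u ⌟ T)_{ij} = g^{st} ∂_t u T_{sij}`. -/
def gradInterior (G : Coord n → Matrix (Fin n) (Fin n) ℝ)
    (τ : Fin n → Fin n → Fin n → Coord n → ℝ) (u : Coord n → ℝ) (i j : Fin n)
    (y : Coord n) : ℝ :=
  ∑ s, ∑ t, (G y)⁻¹ s t * pd t u y * τ s i j y

end Local

/-! ### Tensor fields on a manifold -/

section Global

variable {n : ℕ} {M : Type*} [TopologicalSpace M] [ChartedSpace (Coord n) M]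

/-- A smooth chart of `M`, i.e. a member of the maximal smooth atlas. -/
def IsChart (φ : OpenPartialHomeomorph M (Coord n)) : Prop :=
  φ ∈ IsManifold.maximalAtlas (𝓡 n) ∞ M

variable (n M) in
/-- A (not necessarily smooth) field of alternating 3-forms on the tangent spaces of `M`. -/
abbrev ThreeForm : Type _ := ∀ x : M, TangentSpace (𝓡 n) x [⋀^Fin 3]→L[ℝ] ℝ

/-- The differential of the inverse of a chart. -/
def chartDiff (φ : OpenPartialHomeomorph M (Coord n)) (y : Coord n) :
    Coord n →L[ℝ] TangentSpace (𝓡 n) (φ.symm y) :=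
  mfderiv (𝓡 n) (𝓡 n) φ.symm y

/-- The 3-form `T` in a chart: its pullback to `ℝⁿ` by the inverse of the chart. -/
def localForm (T : ThreeForm n M) (φ : OpenPartialHomeomorph M (Coord n)) (y : Coord n) :
    Coord n [⋀^Fin 3]→L[ℝ] ℝ :=
  (T (φ.symm y)).compContinuousLinearMap (chartDiff φ y)

/-- The components `T_{ijk} = T(∂_i, ∂_j, ∂_k)` in a chart. -/
def components (T : ThreeForm n M) (φ : OpenPartialHomeomorph M (Coord n)) (i j k : Fin n)
    (y : Coord n) : ℝ :=
  localForm T φ y ![basisVec i, basisVec j, basisVec k]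

/-- `T` is a smooth differential form. -/
def IsSmooth (T : ThreeForm n M) : Prop :=
  ∀ φ : OpenPartialHomeomorph M (Coord n), IsChart φ → ContDiffOn ℝ ∞ (localForm T φ) φ.target

/-- `dT = 0`. -/
def IsClosedForm (T : ThreeForm n M) : Prop :=
  ∀ φ : OpenPartialHomeomorph M (Coord n), IsChart φ →
    ∀ y ∈ φ.target, extDeriv (localForm T φ) y = 0

variable [IsManifold (𝓡 n) ∞ M]

variable (n M) in
/-- A smooth Riemannian metric on `M`. -/
abbrev Metric : Type _ :=
  Bundle.ContMDiffRiemannianMetric (𝓡 n) ∞ (Coord n) (fun x : M => TangentSpace (𝓡 n) x)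

/-- The matrix `g_{ij} = g(∂_i, ∂_j)` of the metric in a chart. -/
def localMetric (g : Metric n M) (φ : OpenPartialHomeomorph M (Coord n)) (y : Coord n) :
    Matrix (Fin n) (Fin n) ℝ :=
  Matrix.of fun i j =>
    g.inner (φ.symm y) (chartDiff φ y (basisVec i)) (chartDiff φ y (basisVec j))

/-- `δT = 0`. -/
def IsCoclosedForm (g : Metric n M) (T : ThreeForm n M) : Prop :=
  ∀ φ : OpenPartialHomeomorph M (Coord n), IsChart φ → ∀ y ∈ φ.target, ∀ i j,
    codiff (localMetric g φ) (components T φ) i j y = 0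

/-- `T` is harmonic: `dT = δT = 0`. -/
def IsHarmonic (g : Metric n M) (T : ThreeForm n M) : Prop :=
  IsClosedForm T ∧ IsCoclosedForm g T

/-- `(M, g, T, f)` is a generalized (steady) gradient Ricci soliton:
`Ric^g = ¼ T² - ∇^g ∇^g f`, `δT = - grad f ⌟ T` and `dT = 0`. -/
structure IsGradientSoliton (g : Metric n M) (T : ThreeForm n M) (f : M → ℝ) : Prop where
  ricci_eq : ∀ φ : OpenPartialHomeomorph M (Coord n), IsChart φ → ∀ y ∈ φ.target, ∀ i j,
    ricci (christoffel (localMetric g φ)) i j y =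
      (1 / 4) * torsionSq (localMetric g φ) (components T φ) i j y
        - hessian (localMetric g φ) (f ∘ φ.symm) i j y
  codiff_eq : ∀ φ : OpenPartialHomeomorph M (Coord n), IsChart φ → ∀ y ∈ φ.target, ∀ i j,
    codiff (localMetric g φ) (components T φ) i j y =
      - gradInterior (localMetric g φ) (components T φ) (f ∘ φ.symm) i j y
  closed : IsClosedForm T

/-- `‖T‖²` is a constant function on `M`. -/
def HasConstantNorm (g : Metric n M) (T : ThreeForm n M) : Prop :=
  ∃ c : ℝ, ∀ φ : OpenPartialHomeomorph M (Coord n), IsChart φ → ∀ y ∈ φ.target,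
    normSq (localMetric g φ) (components T φ) y = c

/-- The Riemannian scalar curvature is a constant function on `M`. -/
def HasConstantScalarCurvature (g : Metric n M) : Prop :=
  ∃ c : ℝ, ∀ φ : OpenPartialHomeomorph M (Coord n), IsChart φ → ∀ y ∈ φ.target,
    scalarCurvature (localMetric g φ) y = c

/-- The Ricci tensor of the metric connection with skew torsion `T` vanishes. -/
def IsTorsionRicciFlat (g : Metric n M) (T : ThreeForm n M) : Prop :=
  ∀ φ : OpenPartialHomeomorph M (Coord n), IsChart φ → ∀ y ∈ φ.target, ∀ i j,
    ricci (torsionCoeff (localMetric g φ) (components T φ)) i j y = 0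

end Global

end SkewTorsion

end

open scoped Manifold ContDiff

noncomputable section

namespace SkewTorsion

open Topology

variable {n : ℕ}

/-! ### Partial derivatives -/

section PartialDerivatives

variable {s : Set (Coord n)} {y : Coord n} {u v : Coord n → ℝ}

/-! The theorem rests on one conserved quantity and one maximum principle.

On a gradient soliton `Δf - |∇f|² + ⅙ ‖T‖²` is constant. To see this, take the divergence of `Ric^g
= ¼ T² - ∇∇f`. By the contracted Bianchi identity the left side is `½ d Scal^g`. On the right, `δT =
-grad f ⌟ T` and `dT = 0` give `div T² = T²(∇f) + ⅙ d‖T‖²`, and commuting derivatives gives `div ∇∇f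
= dΔf + Ric^g(∇f)`. Substituting the soliton equation for `Ric^g(∇f)` cancels the terms `T²(∇f)`,
and comparison with the trace `Scal^g = ¼ ‖T‖² - Δf` leaves `d(Δf - |∇f|² + ⅙ ‖T‖²) = 0`. This is
`IsNormalAt.pd_solitonPotential`. It is computed only at a point where `g_{ij} = δ_{ij}` and `∂g =
0`; such charts come from an explicit quadratic change of coordinates (`IsChart.exists_normal`), and
invariance under changes of charts (`IsIsometryOn.solitonPotential_comp`) carries the result
everywhere.

Each of a), c), d) now yields an equation `α Δf - β |∇f|² = k` with constants and `α > 0`. For a)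
and d) insert the constant into the conserved quantity, using the trace for d). For c), `Ric = ½
grad f ⌟ T - ∇∇f` has trace `-Δf`, the first term being skew, so `Δf = 0`. Evaluation at a maximum
and at a minimum of `f` forces `k = 0`; the strong maximum principle, proved by Hopf's barrier, then
makes the set of maximum points open as well as closed, so `f` is constant (`exists_eq_const`).
Conversely, if `f` is constant then the conserved quantity is `⅙ ‖T‖²`, the formula for `Ric` gives
zero, `Scal^g = ¼ ‖T‖²`, and `δT = 0`. -/

lemma differentiableAt_of_contDiffOn (hs : IsOpen s) (hu : ContDiffOn ℝ ∞ u s) (hy : y ∈ s) :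
    DifferentiableAt ℝ u y :=
  (hu.contDiffAt (hs.mem_nhds hy)).differentiableAt (by simp)

lemma contDiffOn_pd (hs : IsOpen s) (hu : ContDiffOn ℝ ∞ u s) (i : Fin n) :
    ContDiffOn ℝ ∞ (pd i u) s :=
  (hu.fderiv_of_isOpen hs (m := ∞) (by simp)).clm_apply contDiffOn_const

lemma pd_congr (hs : IsOpen s) (h : Set.EqOn u v s) (hy : y ∈ s) (i : Fin n) :
    pd i u y = pd i v y := by
  unfold pd
  rw [Filter.EventuallyEq.fderiv_eq (h.eventuallyEq_of_mem (hs.mem_nhds hy))]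

lemma pd_const (i : Fin n) (c : ℝ) : pd i (fun _ => c) y = 0 := by
  simp [pd]

lemma pd_add (hu : DifferentiableAt ℝ u y) (hv : DifferentiableAt ℝ v y) (i : Fin n) :
    pd i (fun z => u z + v z) y = pd i u y + pd i v y := by
  simp [pd, fderiv_fun_add hu hv]

lemma pd_sub (hu : DifferentiableAt ℝ u y) (hv : DifferentiableAt ℝ v y) (i : Fin n) :
    pd i (fun z => u z - v z) y = pd i u y - pd i v y := by
  simp [pd, fderiv_fun_sub hu hv]

lemma pd_neg (i : Fin n) : pd i (fun z => - u z) y = - pd i u y := by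
  simp [pd, fderiv_fun_neg]

lemma pd_mul (hu : DifferentiableAt ℝ u y) (hv : DifferentiableAt ℝ v y) (i : Fin n) :
    pd i (fun z => u z * v z) y = pd i u y * v y + u y * pd i v y := by
  simp [pd, fderiv_fun_mul hu hv]; ring

lemma pd_const_mul (hu : DifferentiableAt ℝ u y) (c : ℝ) (i : Fin n) :
    pd i (fun z => c * u z) y = c * pd i u y := by
  rw [pd_mul (differentiableAt_const c) hu, pd_const]; ring

lemma pd_sum {ι : Type*} (t : Finset ι) {w : ι → Coord n → ℝ}
    (hw : ∀ a, DifferentiableAt ℝ (w a) y) (i : Fin n) :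
    pd i (fun z => ∑ a ∈ t, w a z) y = ∑ a ∈ t, pd i (w a) y := by
  simp [pd, fderiv_fun_sum (fun a _ => hw a)]

lemma pd_comm (hs : IsOpen s) (hu : ContDiffOn ℝ ∞ u s) (hy : y ∈ s) (i j : Fin n) :
    pd i (pd j u) y = pd j (pd i u) y := by
  have h : ContDiffAt ℝ ∞ u y := hu.contDiffAt (hs.mem_nhds hy)
  have hd : DifferentiableAt ℝ (fderiv ℝ u) y :=
    (h.fderiv_right (m := 1) (by norm_cast)).differentiableAt (by simp)
  have hsymm := h.isSymmSndFDerivAt (by simp only [minSmoothness_of_isRCLikeNormedField]; exact WithTop.coe_le_coe.2 (le_top : (2 : ℕ∞) ≤ ⊤))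
  have key : ∀ a b : Fin n, pd a (pd b u) y = fderiv ℝ (fderiv ℝ u) y (basisVec a) (basisVec b) := by
    intro a b
    change fderiv ℝ (fun z => fderiv ℝ u z (basisVec b)) y (basisVec a) = _
    rw [fderiv_clm_apply hd (differentiableAt_const _)]
    simp
  rw [key, key, hsymm]

lemma fderiv_eq_sum_pd (u : Coord n → ℝ) (y v : Coord n) :
    fderiv ℝ u y v = ∑ i, v i * pd i u y := by
  have hv : v = ∑ i, v i • basisVec i := by
    ext j
    simp [basisVec, Pi.single_apply]
  conv_lhs => rw [hv]
  simp [pd]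

end PartialDerivatives

/-! ### Metrics on open sets of `ℝⁿ` -/

/-- `G` is a smooth Riemannian metric on the open set `s`. -/
structure MetricOn (G : Coord n → Matrix (Fin n) (Fin n) ℝ) (s : Set (Coord n)) : Prop where
  isOpen : IsOpen s
  smooth : ∀ i j, ContDiffOn ℝ ∞ (fun z => G z i j) s
  posDef : ∀ z ∈ s, (G z).PosDef

namespace MetricOn

variable {G : Coord n → Matrix (Fin n) (Fin n) ℝ} {s : Set (Coord n)} {y : Coord n}

lemma symm (hG : MetricOn G s) (hy : y ∈ s) (i j : Fin n) : G y i j = G y j i := by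
  simpa using (hG.posDef y hy).1.apply j i

lemma isUnit_det (hG : MetricOn G s) (hy : y ∈ s) : IsUnit (G y).det :=
  (hG.posDef y hy).det_pos.ne'.isUnit

lemma inv_symm (hG : MetricOn G s) (hy : y ∈ s) (i j : Fin n) : (G y)⁻¹ i j = (G y)⁻¹ j i := by
  simpa using (hG.posDef y hy).1.inv.apply j i

lemma sum_inv_mul (hG : MetricOn G s) (hy : y ∈ s) (i j : Fin n) :
    ∑ k, (G y)⁻¹ i k * G y k j = if i = j then 1 else 0 := by
  have := congrFun (congrFun (Matrix.nonsing_inv_mul (G y) (hG.isUnit_det hy)) i) j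
  rw [Matrix.mul_apply, Matrix.one_apply] at this
  exact this

lemma sum_mul_inv (hG : MetricOn G s) (hy : y ∈ s) (i j : Fin n) :
    ∑ k, G y i k * (G y)⁻¹ k j = if i = j then 1 else 0 := by
  have := congrFun (congrFun (Matrix.mul_nonsing_inv (G y) (hG.isUnit_det hy)) i) j
  rw [Matrix.mul_apply, Matrix.one_apply] at this
  exact this

lemma smooth_det {A : Coord n → Matrix (Fin n) (Fin n) ℝ}
    (hA : ∀ i j, ContDiffOn ℝ ∞ (fun z => A z i j) s) : ContDiffOn ℝ ∞ (fun z => (A z).det) s := by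
  simp only [Matrix.det_apply']
  exact ContDiffOn.sum fun σ _ => contDiffOn_const.mul (contDiffOn_prod fun i _ => hA _ _)

/-- Cramer's rule: the entries of the adjugate are determinants of smooth matrices, and `det G` does
not vanish. -/
lemma smooth_inv (hG : MetricOn G s) (i j : Fin n) : ContDiffOn ℝ ∞ (fun z => (G z)⁻¹ i j) s := by
  have h : Set.EqOn (fun z => (G z)⁻¹ i j) (fun z => ((G z).det)⁻¹ * (G z).adjugate i j) s := by
    intro z _
    simp [Matrix.inv_def]
  refine ContDiffOn.congr ?_ h
  refine ((smooth_det hG.smooth).inv fun z hz => (hG.posDef z hz).det_pos.ne').mul ?_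
  simp only [Matrix.adjugate_apply]
  refine smooth_det fun a b => ?_
  by_cases hab : a = j
  · subst hab; simp only [Matrix.updateRow_self]; exact contDiffOn_const
  · simp only [Matrix.updateRow_ne hab]; exact hG.smooth a b

end MetricOn

/-- The lowered Christoffel symbols `2 Γ_{l,ij} = ∂_i g_{jl} + ∂_j g_{il} - ∂_l g_{ij}`. -/
def christoffelLow (G : Coord n → Matrix (Fin n) (Fin n) ℝ) (l i j : Fin n) (y : Coord n) : ℝ :=
  pd i (fun z => G z j l) y + pd j (fun z => G z i l) y - pd l (fun z => G z i j) y

/-! ### Smoothness of the local geometric quantities. -/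

section Smoothness

variable {G : Coord n → Matrix (Fin n) (Fin n) ℝ} {s : Set (Coord n)} {y : Coord n}
  {u : Coord n → ℝ} {τ : Fin n → Fin n → Fin n → Coord n → ℝ}

lemma christoffel_eq_low (k i j : Fin n) (y : Coord n) :
    christoffel G k i j y = (1 / 2) * ∑ l, (G y)⁻¹ k l * christoffelLow G l i j y := rfl

lemma MetricOn.smooth_low (hG : MetricOn G s) (l i j : Fin n) :
    ContDiffOn ℝ ∞ (christoffelLow G l i j) s :=
  ((contDiffOn_pd hG.isOpen (hG.smooth j l) i).add
    (contDiffOn_pd hG.isOpen (hG.smooth i l) j)).sub (contDiffOn_pd hG.isOpen (hG.smooth i j) l)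

lemma MetricOn.smooth_christoffel (hG : MetricOn G s) (k i j : Fin n) :
    ContDiffOn ℝ ∞ (christoffel G k i j) s := by
  refine contDiffOn_const.mul (ContDiffOn.sum fun l _ => ?_)
  exact (hG.smooth_inv k l).mul (hG.smooth_low l i j)

lemma MetricOn.smooth_hessian (hG : MetricOn G s) (hu : ContDiffOn ℝ ∞ u s) (i j : Fin n) :
    ContDiffOn ℝ ∞ (hessian G u i j) s := by
  refine (contDiffOn_pd hG.isOpen (contDiffOn_pd hG.isOpen hu j) i).sub (ContDiffOn.sum fun k _ => ?_)
  exact (hG.smooth_christoffel _ _ _).mul (contDiffOn_pd hG.isOpen hu k)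

lemma MetricOn.smooth_torsionSq (hG : MetricOn G s) (hτ : ∀ i j k, ContDiffOn ℝ ∞ (τ i j k) s)
    (i j : Fin n) : ContDiffOn ℝ ∞ (torsionSq G τ i j) s :=
  ContDiffOn.sum fun _ _ => ContDiffOn.sum fun _ _ => ContDiffOn.sum fun _ _ =>
    ContDiffOn.sum fun _ _ =>
      (((hG.smooth_inv _ _).mul (hG.smooth_inv _ _)).mul (hτ _ _ _)).mul (hτ _ _ _)

/-- The Laplacian `g^{ij} ∇_i ∇_j u`. -/
def laplacian (G : Coord n → Matrix (Fin n) (Fin n) ℝ) (u : Coord n → ℝ) (y : Coord n) : ℝ :=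
  ∑ i, ∑ j, (G y)⁻¹ i j * hessian G u i j y

/-- The squared norm of the gradient `g^{ij} ∂_i u ∂_j u`. -/
def gradSq (G : Coord n → Matrix (Fin n) (Fin n) ℝ) (u : Coord n → ℝ) (y : Coord n) : ℝ :=
  ∑ i, ∑ j, (G y)⁻¹ i j * (pd i u y * pd j u y)

lemma MetricOn.smooth_laplacian (hG : MetricOn G s) (hu : ContDiffOn ℝ ∞ u s) :
    ContDiffOn ℝ ∞ (laplacian G u) s :=
  ContDiffOn.sum fun i _ => ContDiffOn.sum fun k _ =>
    (hG.smooth_inv i k).mul (hG.smooth_hessian hu i k)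

lemma MetricOn.smooth_gradSq (hG : MetricOn G s) (hu : ContDiffOn ℝ ∞ u s) :
    ContDiffOn ℝ ∞ (gradSq G u) s :=
  ContDiffOn.sum fun i _ => ContDiffOn.sum fun k _ => (hG.smooth_inv i k).mul
    ((contDiffOn_pd hG.isOpen hu i).mul (contDiffOn_pd hG.isOpen hu k))

lemma MetricOn.smooth_normSq (hG : MetricOn G s) (hτ : ∀ i j k, ContDiffOn ℝ ∞ (τ i j k) s) :
    ContDiffOn ℝ ∞ (normSq G τ) s :=
  ContDiffOn.sum fun i _ => ContDiffOn.sum fun k _ =>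
    (hG.smooth_inv i k).mul (hG.smooth_torsionSq hτ i k)

end Smoothness

/-! ### The soliton identity at the centre of normal coordinates -/

/-- The coordinates are normal to first order at `y`: `g_{ij} = δ_{ij}` and `∂_k g_{ij} = 0`. -/
structure IsNormalAt (G : Coord n → Matrix (Fin n) (Fin n) ℝ) (y : Coord n) : Prop where
  eq_one : G y = 1
  pd_eq_zero : ∀ k i j, pd k (fun z => G z i j) y = 0

section Normal

variable {G : Coord n → Matrix (Fin n) (Fin n) ℝ} {s : Set (Coord n)} {y : Coord n}
  {u : Coord n → ℝ} {τ : Fin n → Fin n → Fin n → Coord n → ℝ}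

lemma IsNormalAt.inv_apply (hN : IsNormalAt G y) (i j : Fin n) :
    (G y)⁻¹ i j = if i = j then 1 else 0 := by
  rw [hN.eq_one, inv_one, Matrix.one_apply]

lemma IsNormalAt.sum_inv_mul (hN : IsNormalAt G y) (i : Fin n) (X : Fin n → ℝ) :
    ∑ j, (G y)⁻¹ i j * X j = X i := by
  simp [hN.inv_apply]

lemma IsNormalAt.sum_sum_inv_mul (hN : IsNormalAt G y) (X : Fin n → Fin n → ℝ) :
    ∑ i, ∑ j, (G y)⁻¹ i j * X i j = ∑ i, X i i :=
  Finset.sum_congr rfl fun i _ => hN.sum_inv_mul i (X i)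

/-- Differentiate `G⁻¹ G = 1`: the term with `∂G` vanishes at the centre and `G` is the identity
there. -/
lemma IsNormalAt.pd_inv (hN : IsNormalAt G y) (hG : MetricOn G s) (hy : y ∈ s) (k i j : Fin n) :
    pd k (fun z => (G z)⁻¹ i j) y = 0 := by
  have dG : ∀ a b, DifferentiableAt ℝ (fun z => G z a b) y := fun a b =>
    differentiableAt_of_contDiffOn hG.isOpen (hG.smooth a b) hy
  have dI : ∀ a b, DifferentiableAt ℝ (fun z => (G z)⁻¹ a b) y := fun a b =>
    differentiableAt_of_contDiffOn hG.isOpen (hG.smooth_inv a b) hy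
  have h := pd_congr hG.isOpen (fun z hz => hG.sum_inv_mul hz i j) hy k
  rw [pd_const, pd_sum _ (fun a => (dI i a).fun_mul (dG a j))] at h
  rw [← h, Finset.sum_congr rfl fun a _ => pd_mul (dI i a) (dG a j) k]
  simp [hN.pd_eq_zero, hN.eq_one, Matrix.one_apply]



lemma IsNormalAt.pd_sum_inv_mul (hN : IsNormalAt G y) (hG : MetricOn G s) (hy : y ∈ s) {X : Fin n → Coord n → ℝ}
    (hX : ∀ j, DifferentiableAt ℝ (X j) y) (l i : Fin n) :
    pd l (fun z => ∑ j, (G z)⁻¹ i j * X j z) y = pd l (X i) y := by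
  have dI : ∀ a b, DifferentiableAt ℝ (fun z => (G z)⁻¹ a b) y := fun a b =>
    differentiableAt_of_contDiffOn hG.isOpen (hG.smooth_inv a b) hy
  rw [pd_sum _ (fun a => (dI i a).fun_mul (hX a)),
    Finset.sum_congr rfl fun a _ => pd_mul (dI i a) (hX a) l]
  simp [hN.pd_inv hG hy, hN.inv_apply]

lemma IsNormalAt.pd_sum_sum_inv_mul (hN : IsNormalAt G y) (hG : MetricOn G s) (hy : y ∈ s) {X : Fin n → Fin n → Coord n → ℝ}
    (hX : ∀ i j, ContDiffOn ℝ ∞ (X i j) s) (l : Fin n) :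
    pd l (fun z => ∑ i, ∑ j, (G z)⁻¹ i j * X i j z) y = ∑ i, pd l (X i i) y := by
  rw [pd_sum _ fun i => differentiableAt_of_contDiffOn hG.isOpen
    (ContDiffOn.sum fun j _ => (hG.smooth_inv i j).mul (hX i j)) hy]
  exact Finset.sum_congr rfl fun i _ => hN.pd_sum_inv_mul hG hy
    (fun j => differentiableAt_of_contDiffOn hG.isOpen (hX i j) hy) l i

/-- Second derivatives of `G⁻¹` need not vanish at the centre. They are multiplied by `X`, which
explains the condition `X j y = 0`; the mixed terms contain `∂G⁻¹ = 0`. -/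
lemma IsNormalAt.pd_pd_sum_inv_mul (hN : IsNormalAt G y) (hG : MetricOn G s) (hy : y ∈ s) {X : Fin n → Coord n → ℝ}
    (hX : ∀ j, ContDiffOn ℝ ∞ (X j) s) (hX0 : ∀ j, X j y = 0) (m l i : Fin n) :
    pd m (pd l (fun z => ∑ j, (G z)⁻¹ i j * X j z)) y = pd m (pd l (X i)) y := by
  have ho := hG.isOpen
  have h : Set.EqOn (pd l (fun z => ∑ j, (G z)⁻¹ i j * X j z))
      (fun z => ∑ j, pd l (fun w => (G w)⁻¹ i j) z * X j z
        + ∑ j, (G z)⁻¹ i j * pd l (X j) z) s := by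
    intro z hz
    have dI : ∀ a b, DifferentiableAt ℝ (fun z => (G z)⁻¹ a b) z := fun a b =>
      differentiableAt_of_contDiffOn ho (hG.smooth_inv a b) hz
    have dX : ∀ a, DifferentiableAt ℝ (X a) z := fun a =>
      differentiableAt_of_contDiffOn ho (hX a) hz
    simp only
    rw [pd_sum _ (fun a => (dI i a).fun_mul (dX a)),
      Finset.sum_congr rfl fun a _ => pd_mul (dI i a) (dX a) l, Finset.sum_add_distrib]
  have s1 : ∀ j, ContDiffOn ℝ ∞ (pd l (fun w => (G w)⁻¹ i j)) s := fun j =>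
    contDiffOn_pd ho (hG.smooth_inv i j) l
  have s2 : ∀ j, ContDiffOn ℝ ∞ (pd l (X j)) s := fun j => contDiffOn_pd ho (hX j) l
  have d : ∀ {v : Coord n → ℝ}, ContDiffOn ℝ ∞ v s → DifferentiableAt ℝ v y := fun hv =>
    differentiableAt_of_contDiffOn ho hv hy
  rw [pd_congr ho h hy, pd_add (d (ContDiffOn.sum fun j _ => (s1 j).mul (hX j)))
    (d (ContDiffOn.sum fun j _ => (hG.smooth_inv i j).mul (s2 j))),
    hN.pd_sum_inv_mul hG hy (fun j => d (s2 j)), pd_sum _ fun j => d ((s1 j).mul (hX j)),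
    Finset.sum_congr rfl fun j _ => pd_mul (d (s1 j)) (d (hX j)) m]
  simp [hX0, hN.pd_inv hG hy]

lemma IsNormalAt.low_eq_zero (hN : IsNormalAt G y) (l i j : Fin n) : christoffelLow G l i j y = 0 := by
  simp [christoffelLow, hN.pd_eq_zero]

lemma IsNormalAt.christoffel_eq_zero (hN : IsNormalAt G y) (k i j : Fin n) : christoffel G k i j y = 0 := by
  simp [christoffel_eq_low, hN.low_eq_zero]

lemma MetricOn.pd_low (hG : MetricOn G s) (hy : y ∈ s) (l k i j : Fin n) :
    pd l (christoffelLow G k i j) y = pd l (pd i fun z => G z j k) y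
      + pd l (pd j fun z => G z i k) y - pd l (pd k fun z => G z i j) y := by
  have d : ∀ i j k, DifferentiableAt ℝ (pd k fun z => G z i j) y := fun i j k =>
    differentiableAt_of_contDiffOn hG.isOpen (contDiffOn_pd hG.isOpen (hG.smooth i j) k) hy
  unfold christoffelLow
  rw [pd_sub ((d _ _ _).fun_add (d _ _ _)) (d _ _ _), pd_add (d _ _ _) (d _ _ _)]

lemma MetricOn.pd_pd_low (hG : MetricOn G s) (hy : y ∈ s) (m l k i j : Fin n) :
    pd m (pd l (christoffelLow G k i j)) y = pd m (pd l (pd i fun z => G z j k)) y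
      + pd m (pd l (pd j fun z => G z i k)) y - pd m (pd l (pd k fun z => G z i j)) y := by
  have d : ∀ i j k l, DifferentiableAt ℝ (pd l (pd k fun z => G z i j)) y := fun i j k l =>
    differentiableAt_of_contDiffOn hG.isOpen
      (contDiffOn_pd hG.isOpen (contDiffOn_pd hG.isOpen (hG.smooth i j) k) l) hy
  rw [pd_congr hG.isOpen (fun z hz => hG.pd_low hz l k i j) hy,
    pd_sub ((d _ _ _ _).fun_add (d _ _ _ _)) (d _ _ _ _), pd_add (d _ _ _ _) (d _ _ _ _)]

lemma IsNormalAt.pd_christoffel (hN : IsNormalAt G y) (hG : MetricOn G s) (hy : y ∈ s) (l k i j : Fin n) :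
    pd l (christoffel G k i j) y = (1 / 2) * (pd l (pd i fun z => G z j k) y
      + pd l (pd j fun z => G z i k) y - pd l (pd k fun z => G z i j) y) := by
  have hs : ∀ l, DifferentiableAt ℝ (christoffelLow G l i j) y := fun l =>
    differentiableAt_of_contDiffOn hG.isOpen (hG.smooth_low l i j) hy
  rw [← hG.pd_low hy, ← hN.pd_sum_inv_mul hG hy hs l k]
  exact pd_const_mul (differentiableAt_of_contDiffOn hG.isOpen
    (ContDiffOn.sum fun a _ => (hG.smooth_inv k a).mul (hG.smooth_low a i j)) hy) _ _

/-- The lowered symbols vanish at the centre, so the second derivative passes through the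
contraction with `G⁻¹`, and only third derivatives of the metric remain. -/
lemma IsNormalAt.pd_pd_christoffel (hN : IsNormalAt G y) (hG : MetricOn G s) (hy : y ∈ s) (m l k i j : Fin n) :
    pd m (pd l (christoffel G k i j)) y = (1 / 2) * (pd m (pd l (pd i fun z => G z j k)) y
      + pd m (pd l (pd j fun z => G z i k)) y - pd m (pd l (pd k fun z => G z i j)) y) := by
  have ho := hG.isOpen
  have hs : ContDiffOn ℝ ∞ (fun z => ∑ l, (G z)⁻¹ k l * christoffelLow G l i j z) s :=
    ContDiffOn.sum fun a _ => (hG.smooth_inv k a).mul (hG.smooth_low a i j)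
  rw [← hG.pd_pd_low hy, ← hN.pd_pd_sum_inv_mul hG hy (fun l => hG.smooth_low l i j)
    (fun l => hN.low_eq_zero l i j) m l k,
    ← pd_const_mul (differentiableAt_of_contDiffOn ho (contDiffOn_pd ho hs l) hy)]
  exact pd_congr ho (fun z hz => pd_const_mul (differentiableAt_of_contDiffOn ho hs hz) _ _) hy _

lemma IsNormalAt.ricci_eq (hN : IsNormalAt G y) (j k : Fin n) :
    ricci (christoffel G) j k y =
      ∑ i, (pd i (christoffel G i j k) y - pd j (christoffel G i i k) y) := by
  simp [ricci, curvature, hN.christoffel_eq_zero]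

/-- The quadratic part of the curvature is a sum of products of two symbols that both vanish at `y`,
so its first derivative vanishes too. -/
lemma IsNormalAt.pd_ricci (hN : IsNormalAt G y) (hG : MetricOn G s) (hy : y ∈ s) (l j k : Fin n) :
    pd l (ricci (christoffel G) j k) y =
      ∑ i, (pd l (pd i (christoffel G i j k)) y - pd l (pd j (christoffel G i i k)) y) := by
  have ho := hG.isOpen
  have d : ∀ {v : Coord n → ℝ}, ContDiffOn ℝ ∞ v s → DifferentiableAt ℝ v y := fun hv =>
    differentiableAt_of_contDiffOn ho hv hy
  have sΓ := hG.smooth_christoffel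
  have dΓ : ∀ k i j, DifferentiableAt ℝ (christoffel G k i j) y := fun k i j => d (sΓ k i j)
  have s1 : ∀ l k i j, ContDiffOn ℝ ∞ (pd l (christoffel G k i j)) s := fun l k i j =>
    contDiffOn_pd ho (sΓ k i j) l
  have s2 : ∀ i m, ContDiffOn ℝ ∞ (fun z => christoffel G i i m z * christoffel G m j k z
      - christoffel G i j m z * christoffel G m i k z) s := fun i m =>
    ((sΓ _ _ _).mul (sΓ _ _ _)).sub ((sΓ _ _ _).mul (sΓ _ _ _))
  have hq : ∀ i m, pd l (fun z => christoffel G i i m z * christoffel G m j k z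
      - christoffel G i j m z * christoffel G m i k z) y = 0 := fun i m => by
    rw [pd_sub ((dΓ _ _ _).fun_mul (dΓ _ _ _)) ((dΓ _ _ _).fun_mul (dΓ _ _ _)),
      pd_mul (dΓ _ _ _) (dΓ _ _ _), pd_mul (dΓ _ _ _) (dΓ _ _ _)]
    simp [hN.christoffel_eq_zero]
  unfold ricci curvature
  rw [pd_sum _ fun i => d (((s1 _ _ _ _).sub (s1 _ _ _ _)).add (ContDiffOn.sum fun m _ => s2 i m))]
  refine Finset.sum_congr rfl fun i _ => ?_
  rw [pd_add (d ((s1 _ _ _ _).sub (s1 _ _ _ _))) (d (ContDiffOn.sum fun m _ => s2 i m)),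
    pd_sub (d (s1 _ _ _ _)) (d (s1 _ _ _ _)), pd_sum _ fun m => d (s2 i m)]
  simp [hq]

/-- The contracted second Bianchi identity `∇^j Ric_{jk} = ½ ∂_k Scal`. -/
lemma IsNormalAt.contracted_bianchi (hN : IsNormalAt G y) (hG : MetricOn G s) (hy : y ∈ s) (k : Fin n) :
    ∑ j, pd j (ricci (christoffel G) j k) y
      = (1 / 2) * ∑ j, pd k (ricci (christoffel G) j j) y := by
  have ho := hG.isOpen
  have hsym : ∀ i j, Set.EqOn (fun z => G z i j) (fun z => G z j i) s := fun i j z hz =>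
    hG.symm hz i j
  have e1 : ∀ c i j, Set.EqOn (pd c fun z => G z i j) (pd c fun z => G z j i) s :=
    fun c i j z hz => pd_congr ho (hsym i j) hz c
  have e2 : ∀ b c i j, Set.EqOn (pd b (pd c fun z => G z i j)) (pd b (pd c fun z => G z j i)) s :=
    fun b c i j z hz => pd_congr ho (e1 c i j) hz b
  have e3 : ∀ a b c i j, pd a (pd b (pd c fun z => G z i j)) y
      = pd a (pd b (pd c fun z => G z j i)) y := fun a b c i j => pd_congr ho (e2 b c i j) hy a
  have c1 : ∀ a b c i j, pd a (pd b (pd c fun z => G z i j)) y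
      = pd b (pd a (pd c fun z => G z i j)) y := fun a b c i j =>
    pd_comm ho (contDiffOn_pd ho (hG.smooth i j) c) hy a b
  have c2 : ∀ a b c i j, pd a (pd b (pd c fun z => G z i j)) y
      = pd a (pd c (pd b fun z => G z i j)) y := fun a b c i j =>
    pd_congr ho (fun z hz => pd_comm ho (hG.smooth i j) hz b c) hy a
  simp only [hN.pd_ricci hG hy, hN.pd_pd_christoffel hG hy, Finset.mul_sum]
  -- `D a b c i j = ∂_a ∂_b ∂_c g_{ij}` is symmetric in `a, b, c` and in `i, j`; the identity
  -- follows from these symmetries and relabelling of summation indices alone.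
  set D : Fin n → Fin n → Fin n → Fin n → Fin n → ℝ :=
    fun a b c i j => pd a (pd b (pd c fun z => G z i j)) y with hD
  have hB : ∑ j, ∑ i, D i j j k i = ∑ j, ∑ i, D i i j k j := by
    rw [Finset.sum_comm]
    exact Finset.sum_congr rfl fun i _ => Finset.sum_congr rfl fun j _ => by
      simp only [hD]; rw [c1, c2]
  have hC : ∑ j, ∑ i, D k i i j j = ∑ j, ∑ i, D k j j i i := Finset.sum_comm
  -- The first difference on the right disappears after summation by `hB`. What is left is `½ ∂_k
  -- (∂_i ∂_j g_{ij} - ∂_j ∂_j g_{ii})`, which is also half the differential of the trace.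
  have h1 : ∀ j i, 1 / 2 * (pd j (pd i (pd j fun z => G z k i)) y
        + pd j (pd i (pd k fun z => G z j i)) y - pd j (pd i (pd i fun z => G z j k)) y)
      - 1 / 2 * (pd j (pd j (pd i fun z => G z k i)) y + pd j (pd j (pd k fun z => G z i i)) y
        - pd j (pd j (pd i fun z => G z i k)) y)
      = 1 / 2 * (D i j j k i - D i i j k j) + 1 / 2 * (D k i j i j - D k j j i i) := by
    intro j i
    simp only [hD]
    rw [c1 j i j k i, c2 j i k j i, c1 j k i j i, c2 k j i j i, e3 k i j j i, e3 j i i j k, c1 j i i k j,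
      c2 i j i k j, e3 j j i k i, c2 j j k i i, c1 j k j i i]
    ring
  have h2 : ∀ j i, 1 / 2 * (1 / 2 * (pd k (pd i (pd j fun z => G z j i)) y
        + pd k (pd i (pd j fun z => G z j i)) y - pd k (pd i (pd i fun z => G z j j)) y)
      - 1 / 2 * (pd k (pd j (pd i fun z => G z j i)) y + pd k (pd j (pd j fun z => G z i i)) y
        - pd k (pd j (pd i fun z => G z i j)) y))
      = 1 / 2 * D k i j i j - 1 / 4 * (D k i i j j + D k j j i i) := by
    intro j i
    simp only [hD]
    rw [e3 k i j j i, e3 k j i j i]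
    ring
  rw [Finset.sum_congr rfl fun j _ => Finset.sum_congr rfl fun i _ => h1 j i,
    Finset.sum_congr rfl fun j _ => Finset.sum_congr rfl fun i _ => h2 j i]
  simp only [Finset.sum_add_distrib, Finset.sum_sub_distrib, ← Finset.mul_sum]
  rw [hB, hC]
  ring

lemma IsNormalAt.pd_hessian (hN : IsNormalAt G y) (hG : MetricOn G s) (hy : y ∈ s) (hu : ContDiffOn ℝ ∞ u s) (l i j : Fin n) :
    pd l (hessian G u i j) y = pd l (pd i (pd j u)) y
      - ∑ k, pd l (christoffel G k i j) y * pd k u y := by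
  have ho := hG.isOpen
  have d : ∀ {v : Coord n → ℝ}, ContDiffOn ℝ ∞ v s → DifferentiableAt ℝ v y := fun hv =>
    differentiableAt_of_contDiffOn ho hv hy
  have s1 : ∀ i, ContDiffOn ℝ ∞ (pd i u) s := contDiffOn_pd ho hu
  have sΓ := hG.smooth_christoffel
  unfold hessian
  rw [pd_sub (d (contDiffOn_pd ho (s1 j) i)) (d (ContDiffOn.sum fun k _ => (sΓ k i j).mul (s1 k))),
    pd_sum _ fun k => d ((sΓ k i j).mul (s1 k)),
    Finset.sum_congr rfl fun k _ => pd_mul (d (sΓ k i j)) (d (s1 k)) l]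
  simp [hN.christoffel_eq_zero]

/-- The commutation formula `∇^i ∇_i ∇_j u = ∂_j Δu + Ric_{jk} ∂^k u`. -/
lemma IsNormalAt.bochner (hN : IsNormalAt G y) (hG : MetricOn G s) (hy : y ∈ s) (hu : ContDiffOn ℝ ∞ u s) (j : Fin n) :
    ∑ i, pd i (hessian G u i j) y = ∑ i, pd j (hessian G u i i) y
      + ∑ k, ricci (christoffel G) j k y * pd k u y := by
  have ho := hG.isOpen
  have c3 : ∀ i, pd i (pd i (pd j u)) y = pd j (pd i (pd i u)) y := fun i => by
    rw [pd_congr ho (fun z hz => pd_comm ho hu hz i j) hy,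
      pd_comm ho (contDiffOn_pd ho hu i) hy]
  have cG : ∀ a b i j, pd a (pd b fun z => G z i j) y = pd b (pd a fun z => G z i j) y :=
    fun a b i j => pd_comm ho (hG.smooth i j) hy a b
  have eG : ∀ a b i j, pd a (pd b fun z => G z i j) y = pd a (pd b fun z => G z j i) y :=
    fun a b i j => pd_congr ho
      (fun z hz => pd_congr ho (fun w hw => hG.symm hw i j) hz b) hy a
  have hR : ∑ k, ricci (christoffel G) j k y * pd k u y = ∑ i, ∑ k,
      (pd i (christoffel G i j k) y - pd j (christoffel G i i k) y) * pd k u y := by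
    rw [Finset.sum_comm]
    simp only [hN.ricci_eq, Finset.sum_mul]
  rw [hR, ← Finset.sum_add_distrib]
  refine Finset.sum_congr rfl fun i _ => ?_
  -- The third derivatives of `u` agree. The coefficients of each `∂_k u` can then be compared for
  -- fixed `i` and `k`, and involve only second derivatives of the metric.
  rw [hN.pd_hessian hG hy hu, hN.pd_hessian hG hy hu, c3, sub_add, sub_right_inj,
    ← Finset.sum_sub_distrib]
  refine Finset.sum_congr rfl fun k _ => ?_
  rw [hN.pd_christoffel hG hy, hN.pd_christoffel hG hy, hN.pd_christoffel hG hy,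
    hN.pd_christoffel hG hy, cG j i i k, cG j k i i, eG i j k i, eG i k j i, cG i j i k, eG j i k i]
  ring

end Normal

/-- The components `τ` are totally skew-symmetric. -/
structure IsAlternating (τ : Fin n → Fin n → Fin n → Coord n → ℝ) : Prop where
  swap_left : ∀ i j k z, τ i j k z = - τ j i k z
  swap_right : ∀ i j k z, τ i j k z = - τ i k j z

/-- The vanishing of the exterior derivative of `τ` at `y`, in components. -/
def IsClosedAt (τ : Fin n → Fin n → Fin n → Coord n → ℝ) (y : Coord n) : Prop :=
  ∀ i j a b, pd i (τ j a b) y - pd j (τ i a b) y + pd a (τ i j b) y - pd b (τ i j a) y = 0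

/-- The function `Δu - |∇u|² + ⅙ ‖τ‖²`, which is constant on a gradient soliton. -/
def solitonPotential (G : Coord n → Matrix (Fin n) (Fin n) ℝ)
    (τ : Fin n → Fin n → Fin n → Coord n → ℝ) (u : Coord n → ℝ) (y : Coord n) : ℝ :=
  laplacian G u y - gradSq G u y + (1 / 6) * normSq G τ y

/-! ### Closed 3-forms and the differential of the soliton potential. -/

section Identity

variable {G : Coord n → Matrix (Fin n) (Fin n) ℝ} {s : Set (Coord n)} {y : Coord n}
  {u : Coord n → ℝ} {τ : Fin n → Fin n → Fin n → Coord n → ℝ}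

lemma IsAlternating.pd_swap_left (hτ : IsAlternating τ) (l i j k : Fin n) (y : Coord n) :
    pd l (τ i j k) y = - pd l (τ j i k) y := by
  rw [← pd_neg]
  exact congrArg (fun v => pd l v y) (funext (hτ.swap_left i j k))

/-- Contraction of `dτ = 0` with `τ`. -/
lemma IsAlternating.contract_closed (hτ : IsAlternating τ) (hc : IsClosedAt τ y) (j : Fin n) :
    3 * ∑ i, ∑ a, ∑ b, τ i a b y * pd i (τ j a b) y
      = ∑ i, ∑ a, ∑ b, τ i a b y * pd j (τ i a b) y := by
  -- Of the four terms of `dτ` contracted with `τ`, the three that differentiate in the direction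
  -- `i`, `a` or `b` have the same sum up to renaming, hence the factor 3.
  have h : ∀ i a b, τ i a b y * pd i (τ j a b) y + τ a i b y * pd a (τ j i b) y
      + τ b i a y * pd b (τ j i a) y = τ i a b y * pd j (τ i a b) y := by
    intro i a b
    have := hc i j a b
    rw [hτ.pd_swap_left a i j b, hτ.pd_swap_left b i j a] at this
    rw [hτ.swap_left a i b y, hτ.swap_left b i a y, hτ.swap_right i b a y]
    linear_combination τ i a b y * this
  have h1 : ∑ i, ∑ a, ∑ b, τ a i b y * pd a (τ j i b) y
      = ∑ i, ∑ a, ∑ b, τ i a b y * pd i (τ j a b) y := Finset.sum_comm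
  have h2 : ∑ i, ∑ a, ∑ b, τ b i a y * pd b (τ j i a) y
      = ∑ i, ∑ a, ∑ b, τ i a b y * pd i (τ j a b) y :=
    (Finset.sum_congr rfl fun i _ => Finset.sum_comm).trans Finset.sum_comm
  rw [← Finset.sum_congr rfl fun i _ => Finset.sum_congr rfl fun a _ =>
    Finset.sum_congr rfl fun b _ => h i a b]
  simp only [Finset.sum_add_distrib]
  rw [h1, h2]
  ring

/-- In this nested form the lemmas on a double contraction with `G⁻¹` apply twice. -/
lemma torsionSq_eq (i j : Fin n) (y : Coord n) : torsionSq G τ i j y =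
    ∑ a, ∑ c, (G y)⁻¹ a c * ∑ b, ∑ d, (G y)⁻¹ b d * (τ i a b y * τ j c d y) := by
  unfold torsionSq
  refine Finset.sum_congr rfl fun a _ => ?_
  rw [Finset.sum_comm]
  refine Finset.sum_congr rfl fun c _ => ?_
  rw [Finset.mul_sum]
  refine Finset.sum_congr rfl fun b _ => ?_
  rw [Finset.mul_sum]
  exact Finset.sum_congr rfl fun d _ => by ring

lemma IsNormalAt.torsionSq_apply (hN : IsNormalAt G y) (i j : Fin n) :
    torsionSq G τ i j y = ∑ a, ∑ b, τ i a b y * τ j a b y := by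
  rw [torsionSq_eq, hN.sum_sum_inv_mul]
  exact Finset.sum_congr rfl fun a _ => hN.sum_sum_inv_mul _

lemma IsNormalAt.pd_torsionSq (hN : IsNormalAt G y) (hG : MetricOn G s) (hy : y ∈ s)
    (hτ : ∀ i j k, ContDiffOn ℝ ∞ (τ i j k) s) (l i j : Fin n) :
    pd l (torsionSq G τ i j) y
      = ∑ a, ∑ b, (pd l (τ i a b) y * τ j a b y + τ i a b y * pd l (τ j a b) y) := by
  have dτ : ∀ i j k, DifferentiableAt ℝ (τ i j k) y := fun i j k =>
    differentiableAt_of_contDiffOn hG.isOpen (hτ i j k) hy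
  rw [funext fun z => torsionSq_eq (G := G) (τ := τ) i j z, hN.pd_sum_sum_inv_mul hG hy fun a c =>
    ContDiffOn.sum fun b _ => ContDiffOn.sum fun d _ =>
      (hG.smooth_inv b d).mul ((hτ i a b).mul (hτ j c d))]
  refine Finset.sum_congr rfl fun a _ => ?_
  rw [hN.pd_sum_sum_inv_mul hG hy fun b d => (hτ i a b).mul (hτ j a d)]
  exact Finset.sum_congr rfl fun b _ => pd_mul (dτ _ _ _) (dτ _ _ _) l

lemma IsNormalAt.codiff_apply (hN : IsNormalAt G y) (i j : Fin n) :
    codiff G τ i j y = - ∑ m, pd m (τ m i j) y := by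
  unfold codiff
  rw [hN.sum_sum_inv_mul]
  simp [covDeriv, hN.christoffel_eq_zero]

lemma IsNormalAt.gradInterior_apply (hN : IsNormalAt G y) (i j : Fin n) :
    gradInterior G τ u i j y = ∑ m, pd m u y * τ m i j y := by
  unfold gradInterior
  simp only [mul_assoc]
  exact hN.sum_sum_inv_mul _

lemma IsNormalAt.hessian_apply (hN : IsNormalAt G y) (i j : Fin n) :
    hessian G u i j y = pd i (pd j u) y := by
  simp [hessian, hN.christoffel_eq_zero]

/-- On a gradient soliton `Δu - |∇u|² + ⅙ ‖τ‖²` has vanishing differential. -/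
theorem IsNormalAt.pd_solitonPotential (hN : IsNormalAt G y) (hG : MetricOn G s) (hy : y ∈ s)
    (hu : ContDiffOn ℝ ∞ u s) (hτ : ∀ i j k, ContDiffOn ℝ ∞ (τ i j k) s)
    (halt : IsAlternating τ) (hclosed : IsClosedAt τ y)
    (hric : ∀ z ∈ s, ∀ i j, ricci (christoffel G) i j z
      = (1 / 4) * torsionSq G τ i j z - hessian G u i j z)
    (hcod : ∀ i j, codiff G τ i j y = - gradInterior G τ u i j y) (j : Fin n) :
    pd j (solitonPotential G τ u) y = 0 := by
  have ho := hG.isOpen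
  have d : ∀ {v : Coord n → ℝ}, ContDiffOn ℝ ∞ v s → DifferentiableAt ℝ v y := fun hv =>
    differentiableAt_of_contDiffOn ho hv hy
  have su : ∀ i, ContDiffOn ℝ ∞ (pd i u) s := contDiffOn_pd ho hu
  have sH := hG.smooth_hessian hu
  have sT := hG.smooth_torsionSq hτ
  -- The only use of the equation for `δT`: the divergence of `τ` becomes a contraction with the
  -- gradient.
  have hcod' : ∀ a b, ∑ m, pd m (τ m a b) y = ∑ m, pd m u y * τ m a b y := fun a b => by
    have := hcod a b
    rw [hN.codiff_apply, hN.gradInterior_apply] at this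
    linarith
  have hpr : ∀ l i k, pd l (ricci (christoffel G) i k) y
      = (1 / 4) * pd l (torsionSq G τ i k) y - pd l (hessian G u i k) y := fun l i k => by
    rw [pd_congr ho (fun z hz => hric z hz i k) hy,
      pd_sub (d (contDiffOn_const.mul (sT i k))) (d (sH i k)), pd_const_mul (d (sT i k))]
  -- The derivative falls on one of the two factors: on the first it produces the divergence of `τ`,
  -- on the second the expression treated by `contract_closed`.
  have hT1 : ∑ i, pd i (torsionSq G τ i j) y = ∑ m, torsionSq G τ j m y * pd m u y
      + ∑ i, ∑ a, ∑ b, τ i a b y * pd i (τ j a b) y := by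
    simp only [hN.pd_torsionSq hG hy hτ, hN.torsionSq_apply, Finset.sum_add_distrib]
    congr 1
    have e1 : ∑ i, ∑ a, ∑ b, pd i (τ i a b) y * τ j a b y
        = ∑ a, ∑ b, (∑ i, pd i (τ i a b) y) * τ j a b y := by
      rw [Finset.sum_comm]
      refine Finset.sum_congr rfl fun a _ => ?_
      rw [Finset.sum_comm]
      simp only [Finset.sum_mul]
    have e2 : ∑ m, (∑ a, ∑ b, τ j a b y * τ m a b y) * pd m u y
        = ∑ a, ∑ b, (∑ m, pd m u y * τ m a b y) * τ j a b y := by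
      simp only [Finset.sum_mul]
      rw [Finset.sum_comm]
      refine Finset.sum_congr rfl fun a _ => ?_
      rw [Finset.sum_comm]
      exact Finset.sum_congr rfl fun b _ => Finset.sum_congr rfl fun m _ => by ring
    rw [e1, e2]
    simp only [hcod']
  have hT2 : ∑ i, pd j (torsionSq G τ i i) y
      = 2 * ∑ i, ∑ a, ∑ b, τ i a b y * pd j (τ i a b) y := by
    simp only [hN.pd_torsionSq hG hy hτ, Finset.mul_sum]
    exact Finset.sum_congr rfl fun i _ => Finset.sum_congr rfl fun a _ =>
      Finset.sum_congr rfl fun b _ => by ring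
  have hX := halt.contract_closed hclosed j
  have hB := hN.contracted_bianchi hG hy j
  have hbo := hN.bochner hG hy hu j
  have hRic : ∑ k, ricci (christoffel G) j k y * pd k u y
      = (1 / 4) * ∑ k, torsionSq G τ j k y * pd k u y - ∑ k, pd k u y * pd j (pd k u) y := by
    rw [Finset.mul_sum, ← Finset.sum_sub_distrib]
    refine Finset.sum_congr rfl fun k _ => ?_
    rw [hric y hy, hN.hessian_apply]
    ring
  simp only [hpr, Finset.sum_sub_distrib, ← Finset.mul_sum] at hB
  have sL := hG.smooth_laplacian hu
  have sS := hG.smooth_gradSq hu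
  have sN := hG.smooth_normSq hτ
  have hL : pd j (laplacian G u) y = ∑ i, pd j (hessian G u i i) y :=
    hN.pd_sum_sum_inv_mul hG hy sH j
  have hS : pd j (gradSq G u) y = 2 * ∑ k, pd k u y * pd j (pd k u) y := by
    refine (hN.pd_sum_sum_inv_mul hG hy (fun i k => (su i).mul (su k)) j).trans ?_
    rw [Finset.mul_sum]
    refine Finset.sum_congr rfl fun k _ => ?_
    rw [pd_mul (d (su k)) (d (su k))]
    ring
  have hNq : pd j (normSq G τ) y = ∑ i, pd j (torsionSq G τ i i) y :=
    hN.pd_sum_sum_inv_mul hG hy sT j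
  unfold solitonPotential
  rw [pd_add (d (sL.sub sS)) (d (contDiffOn_const.mul sN)), pd_sub (d sL) (d sS),
    pd_const_mul (d sN), hL, hS, hNq]
  -- With `N = ‖τ‖²`, the two sides of Bianchi become `∂_j N / 24 - ∂_j Δu + ½ ∂_j |∇u|²` and `∂_j N
  -- / 8 - ½ ∂_j Δu`; the terms `T²(∇u)` have cancelled.
  rw [hT1, hT2, hbo, hRic] at hB
  rw [hT2]
  linarith

end Identity

/-! ### Changes of coordinates -/

/-- The entry `∂_i ψ^a` of the Jacobian matrix. -/
def jacobian (ψ : Coord n → Coord n) (a i : Fin n) : Coord n → ℝ := pd i fun w => ψ w a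

/-- `ψ` is a change of coordinates from `s'` to `s` which pulls back the metric `G` to `G'`. -/
structure IsIsometryOn (ψ : Coord n → Coord n) (G' : Coord n → Matrix (Fin n) (Fin n) ℝ)
    (s' : Set (Coord n)) (G : Coord n → Matrix (Fin n) (Fin n) ℝ) (s : Set (Coord n)) : Prop where
  source : MetricOn G' s'
  target : MetricOn G s
  smooth : ∀ a, ContDiffOn ℝ ∞ (fun w => ψ w a) s'
  mapsTo : Set.MapsTo ψ s' s
  metric_eq : ∀ z ∈ s', ∀ i j, G' z i j =
    ∑ a, ∑ b, jacobian ψ a i z * jacobian ψ b j z * G (ψ z) a b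

lemma pd_comp {ψ : Coord n → Coord n} {v : Coord n → ℝ} {z : Coord n}
    (hψ : ∀ a, DifferentiableAt ℝ (fun w => ψ w a) z) (hv : DifferentiableAt ℝ v (ψ z))
    (i : Fin n) : pd i (fun w => v (ψ w)) z = ∑ a, jacobian ψ a i z * pd a v (ψ z) := by
  have hψ' : DifferentiableAt ℝ ψ z := differentiableAt_euclidean.2 hψ
  unfold pd
  rw [show (fun w => v (ψ w)) = v ∘ ψ from rfl, fderiv_comp z hv hψ',
    ContinuousLinearMap.comp_apply, fderiv_eq_sum_pd]
  refine Finset.sum_congr rfl fun a _ => ?_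
  congr 1
  have := ((EuclideanSpace.proj (𝕜 := ℝ) a).hasFDerivAt.comp z hψ'.hasFDerivAt).fderiv
  unfold jacobian pd
  rw [show (fun w => ψ w a) = (EuclideanSpace.proj (𝕜 := ℝ) a) ∘ ψ from rfl, this]
  rfl

/-- Contractions over independent pairs of indices commute, so a tensor can be transformed one index
pair at a time. -/
lemma sum_four_comm (A B : Fin n → Fin n → ℝ) (F : Fin n → Fin n → Fin n → Fin n → ℝ) :
    ∑ i, ∑ j, A i j * ∑ p, ∑ q, B p q * F i j p q
      = ∑ p, ∑ q, B p q * ∑ i, ∑ j, A i j * F i j p q := by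
  have h : ∀ f : Fin n → Fin n → Fin n → Fin n → ℝ,
      ∑ i, ∑ j, ∑ p, ∑ q, f i j p q = ∑ p, ∑ q, ∑ i, ∑ j, f i j p q := fun f =>
    have cyc : ∀ g : Fin n → Fin n → Fin n → ℝ, ∑ i, ∑ j, ∑ p, g i j p = ∑ p, ∑ i, ∑ j, g i j p :=
      fun g => (Finset.sum_congr rfl fun _ _ => Finset.sum_comm).trans Finset.sum_comm
    (cyc _).trans (Finset.sum_congr rfl fun _ _ => cyc _)
  simp only [Finset.mul_sum]
  rw [h]
  exact Finset.sum_congr rfl fun _ _ => Finset.sum_congr rfl fun _ _ =>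
    Finset.sum_congr rfl fun _ _ => Finset.sum_congr rfl fun _ _ => by ring

namespace IsIsometryOn

variable {ψ : Coord n → Coord n} {G' G : Coord n → Matrix (Fin n) (Fin n) ℝ}
  {s' s : Set (Coord n)} {z : Coord n} {u : Coord n → ℝ}
  {τ τ' : Fin n → Fin n → Fin n → Coord n → ℝ}

lemma smooth_jacobian (h : IsIsometryOn ψ G' s' G s) (a i : Fin n) :
    ContDiffOn ℝ ∞ (jacobian ψ a i) s' := contDiffOn_pd h.source.isOpen (h.smooth a) i

/-- In matrices `G' = Jᵀ G J`, hence `J G'⁻¹ Jᵀ = G⁻¹`. The invertibility of `J` is not assumed: it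
follows from `det G' ≠ 0`. -/
lemma sum_jacobian_inv (h : IsIsometryOn ψ G' s' G s) (hz : z ∈ s') (a b : Fin n) :
    ∑ i, ∑ j, jacobian ψ a i z * (G' z)⁻¹ i j * jacobian ψ b j z = (G (ψ z))⁻¹ a b := by
  set J : Matrix (Fin n) (Fin n) ℝ := Matrix.of fun a i => jacobian ψ a i z with hJ
  have hG' : G' z = J.transpose * G (ψ z) * J := by
    ext i j
    rw [h.metric_eq z hz, Matrix.mul_apply, Finset.sum_comm]
    refine Finset.sum_congr rfl fun b _ => ?_
    rw [Matrix.mul_apply, Finset.sum_mul]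
    refine Finset.sum_congr rfl fun a _ => ?_
    simp only [hJ, Matrix.transpose_apply, Matrix.of_apply]
    ring
  have hdet := h.source.isUnit_det hz
  have hJu : IsUnit J.det := by
    rw [hG', Matrix.det_mul] at hdet
    exact isUnit_of_mul_isUnit_right hdet
  have hJt : IsUnit J.transpose.det := by rwa [Matrix.det_transpose]
  have key : J * (G' z)⁻¹ * J.transpose = (G (ψ z))⁻¹ := by
    rw [hG', Matrix.mul_inv_rev, Matrix.mul_inv_rev, ← Matrix.mul_assoc, ← Matrix.mul_assoc,
      Matrix.mul_nonsing_inv _ hJu, Matrix.one_mul, Matrix.mul_assoc,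
      Matrix.nonsing_inv_mul _ hJt, Matrix.mul_one]
  rw [← key, Matrix.mul_apply, Finset.sum_comm]
  refine Finset.sum_congr rfl fun j _ => ?_
  rw [Matrix.mul_apply, Finset.sum_mul]
  rfl

/-- Contraction with the inverse metric is invariant. -/
lemma contract (h : IsIsometryOn ψ G' s' G s) (hz : z ∈ s') (B : Fin n → Fin n → ℝ) :
    ∑ i, ∑ j, (G' z)⁻¹ i j * ∑ a, ∑ b, jacobian ψ a i z * jacobian ψ b j z * B a b
      = ∑ a, ∑ b, (G (ψ z))⁻¹ a b * B a b := by
  have e : ∀ i j, (G' z)⁻¹ i j * ∑ a, ∑ b, jacobian ψ a i z * jacobian ψ b j z * B a b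
      = ∑ a, ∑ b, jacobian ψ a i z * (G' z)⁻¹ i j * jacobian ψ b j z * B a b := by
    intro i j
    simp only [Finset.mul_sum]
    exact Finset.sum_congr rfl fun a _ => Finset.sum_congr rfl fun b _ => by ring
  simp only [e, ← h.sum_jacobian_inv hz, Finset.sum_mul]
  calc _ = ∑ i, ∑ a, ∑ j, ∑ b, jacobian ψ a i z * (G' z)⁻¹ i j * jacobian ψ b j z * B a b :=
        Finset.sum_congr rfl fun i _ => Finset.sum_comm
    _ = ∑ a, ∑ i, ∑ j, ∑ b, jacobian ψ a i z * (G' z)⁻¹ i j * jacobian ψ b j z * B a b :=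
        Finset.sum_comm
    _ = ∑ a, ∑ i, ∑ b, ∑ j, jacobian ψ a i z * (G' z)⁻¹ i j * jacobian ψ b j z * B a b :=
        Finset.sum_congr rfl fun a _ => Finset.sum_congr rfl fun i _ => Finset.sum_comm
    _ = _ := Finset.sum_congr rfl fun a _ => Finset.sum_comm

lemma contract_mul (h : IsIsometryOn ψ G' s' G s) (hz : z ∈ s') (x y : Fin n → ℝ) :
    ∑ i, ∑ j, (G' z)⁻¹ i j * ((∑ a, jacobian ψ a i z * x a) * ∑ b, jacobian ψ b j z * y b)
      = ∑ a, ∑ b, (G (ψ z))⁻¹ a b * (x a * y b) := by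
  rw [← h.contract hz]
  refine Finset.sum_congr rfl fun i _ => Finset.sum_congr rfl fun j _ => ?_
  rw [Finset.sum_mul_sum]
  congr 1
  exact Finset.sum_congr rfl fun a _ => Finset.sum_congr rfl fun b _ => by ring

lemma differentiableAt (h : IsIsometryOn ψ G' s' G s) (hz : z ∈ s') (a : Fin n) :
    DifferentiableAt ℝ (fun w => ψ w a) z :=
  differentiableAt_of_contDiffOn h.source.isOpen (h.smooth a) hz

lemma pd_comp (h : IsIsometryOn ψ G' s' G s) (hz : z ∈ s') (hu : ContDiffOn ℝ ∞ u s)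
    (i : Fin n) : pd i (fun w => u (ψ w)) z = ∑ a, jacobian ψ a i z * pd a u (ψ z) :=
  SkewTorsion.pd_comp (h.differentiableAt hz)
    (differentiableAt_of_contDiffOn h.target.isOpen hu (h.mapsTo hz)) i

lemma differentiableAt_comp (h : IsIsometryOn ψ G' s' G s) (hz : z ∈ s')
    (hu : ContDiffOn ℝ ∞ u s) : DifferentiableAt ℝ (fun w => u (ψ w)) z :=
  (differentiableAt_of_contDiffOn h.target.isOpen hu (h.mapsTo hz)).comp z
    (differentiableAt_euclidean.2 (h.differentiableAt hz))

theorem gradSq_comp (h : IsIsometryOn ψ G' s' G s) (hz : z ∈ s') (hu : ContDiffOn ℝ ∞ u s) :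
    gradSq G' (fun w => u (ψ w)) z = gradSq G u (ψ z) := by
  unfold gradSq
  simp only [h.pd_comp hz hu]
  exact h.contract_mul hz _ _

lemma pd_metric (h : IsIsometryOn ψ G' s' G s) (hz : z ∈ s') (l i j : Fin n) :
    pd l (fun w => G' w i j) z = ∑ a, ∑ b,
      ((pd l (jacobian ψ a i) z * jacobian ψ b j z + jacobian ψ a i z * pd l (jacobian ψ b j) z)
        * G (ψ z) a b + ∑ c, jacobian ψ c l z * jacobian ψ a i z * jacobian ψ b j z
          * pd c (fun w => G w a b) (ψ z)) := by
  have ho := h.source.isOpen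
  have dJ : ∀ a i, DifferentiableAt ℝ (jacobian ψ a i) z := fun a i =>
    differentiableAt_of_contDiffOn ho (h.smooth_jacobian a i) hz
  have dG : ∀ a b, DifferentiableAt ℝ (fun w => G (ψ w) a b) z := fun a b =>
    h.differentiableAt_comp hz (h.target.smooth a b)
  rw [pd_congr ho (fun w hw => h.metric_eq w hw i j) hz,
    pd_sum _ fun a => DifferentiableAt.fun_sum fun b _ => ((dJ a i).fun_mul (dJ b j)).fun_mul (dG a b)]
  refine Finset.sum_congr rfl fun a _ => ?_
  rw [pd_sum _ fun b => ((dJ a i).fun_mul (dJ b j)).fun_mul (dG a b)]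
  refine Finset.sum_congr rfl fun b _ => ?_
  rw [pd_mul ((dJ a i).fun_mul (dJ b j)) (dG a b), pd_mul (dJ a i) (dJ b j),
    h.pd_comp hz (h.target.smooth a b), Finset.mul_sum]
  congr 1
  exact Finset.sum_congr rfl fun c _ => by ring

lemma pd_jacobian_comm (h : IsIsometryOn ψ G' s' G s) (hz : z ∈ s') (a i j : Fin n) :
    pd i (jacobian ψ a j) z = pd j (jacobian ψ a i) z :=
  pd_comm h.source.isOpen (h.smooth a) hz i j

/-- The transformation law of the lowered Christoffel symbols. -/
lemma low_eq (h : IsIsometryOn ψ G' s' G s) (hz : z ∈ s') (l i j : Fin n) :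
    christoffelLow G' l i j z = ∑ c, jacobian ψ c l z *
      (2 * ∑ a, G (ψ z) c a * pd i (jacobian ψ a j) z
        + ∑ a, ∑ b, jacobian ψ a i z * jacobian ψ b j z * christoffelLow G c a b (ψ z)) := by
  set J : Fin n → Fin n → ℝ := fun a i => jacobian ψ a i z with hJ
  set K : Fin n → Fin n → Fin n → ℝ := fun a i j => pd i (jacobian ψ a j) z with hK
  set g : Fin n → Fin n → ℝ := fun a b => G (ψ z) a b with hg
  set D : Fin n → Fin n → Fin n → ℝ := fun c a b => pd c (fun w => G w a b) (ψ z) with hD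
  have hKs : ∀ a i j, K a i j = K a j i := fun a i j => h.pd_jacobian_comm hz a i j
  have hgs : ∀ a b, g a b = g b a := fun a b => h.target.symm (h.mapsTo hz) a b
  have hp : ∀ l i j, pd l (fun w => G' w i j) z
      = ∑ a, ∑ b, K a l i * J b j * g a b + ∑ a, ∑ b, J b i * K a l j * g a b
        + ∑ a, ∑ b, ∑ c, J c l * J a i * J b j * D c a b := by
    intro l i j
    rw [h.pd_metric hz, show ∑ a, ∑ b, J b i * K a l j * g a b = ∑ a, ∑ b, J a i * K b l j * g a b by
      rw [Finset.sum_comm]; simp only [hgs]]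
    simp only [← Finset.sum_add_distrib]
    refine Finset.sum_congr rfl fun a _ => Finset.sum_congr rfl fun b _ => ?_
    simp only [hJ, hK, hg, hD]
    ring
  have hcyc : ∀ (F : Fin n → Fin n → Fin n → ℝ), ∑ a, ∑ b, ∑ c, F a b c = ∑ c, ∑ a, ∑ b, F a b c :=
    fun F => (Finset.sum_congr rfl fun a _ => Finset.sum_comm).trans Finset.sum_comm
  have t1 : ∑ a, ∑ b, ∑ c, J c i * J a j * J b l * D c a b
      = ∑ c, ∑ a, ∑ b, J c l * (J a i * J b j * D a b c) :=
    (hcyc _).trans <| (Finset.sum_congr rfl fun _ _ => Finset.sum_congr rfl fun _ _ =>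
      Finset.sum_congr rfl fun _ _ => by ring).trans (hcyc _)
  have t2 : ∑ a, ∑ b, ∑ c, J c j * J a i * J b l * D c a b
      = ∑ c, ∑ a, ∑ b, J c l * (J a i * J b j * D b a c) :=
    Finset.sum_comm.trans <| Finset.sum_congr rfl fun _ _ => Finset.sum_congr rfl fun _ _ =>
      Finset.sum_congr rfl fun _ _ => by ring
  have t3 : ∑ a, ∑ b, ∑ c, J c l * J a i * J b j * D c a b
      = ∑ c, ∑ a, ∑ b, J c l * (J a i * J b j * D c a b) :=
    (hcyc _).trans <| Finset.sum_congr rfl fun _ _ => Finset.sum_congr rfl fun _ _ =>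
      Finset.sum_congr rfl fun _ _ => by ring
  have t4 : ∑ a, ∑ b, K a i j * J b l * g a b = ∑ c, J c l * ∑ a, g c a * K a i j := by
    rw [Finset.sum_comm]
    refine Finset.sum_congr rfl fun c _ => ?_
    rw [Finset.mul_sum]
    exact Finset.sum_congr rfl fun a _ => by rw [hgs c a]; ring
  have hR : ∑ c, J c l * (2 * ∑ a, g c a * K a i j
        + ∑ a, ∑ b, J a i * J b j * christoffelLow G c a b (ψ z))
      = 2 * ∑ c, J c l * ∑ a, g c a * K a i j + (∑ c, ∑ a, ∑ b, J c l * (J a i * J b j * D a b c)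
        + ∑ c, ∑ a, ∑ b, J c l * (J a i * J b j * D b a c)
        - ∑ c, ∑ a, ∑ b, J c l * (J a i * J b j * D c a b)) := by
    rw [Finset.mul_sum]
    simp only [← Finset.sum_add_distrib, ← Finset.sum_sub_distrib]
    refine Finset.sum_congr rfl fun c _ => ?_
    rw [mul_add, mul_left_comm]
    congr 1
    rw [Finset.mul_sum]
    refine Finset.sum_congr rfl fun a _ => ?_
    rw [Finset.mul_sum]
    refine Finset.sum_congr rfl fun b _ => ?_
    simp only [christoffelLow, hD]
    ring
  refine Eq.trans ?_ hR.symm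
  unfold christoffelLow
  rw [hp, hp, hp, t1, t2, t3]
  -- Six terms contain second derivatives of `ψ`. Since `K` is symmetric in its last two indices,
  -- two of them coincide, which gives the factor 2, and the other four cancel in pairs.
  have t5 : ∑ a, ∑ b, K a j i * J b l * g a b = ∑ c, J c l * ∑ a, g c a * K a i j := by
    rw [← t4]; simp only [hKs _ j i]
  have t6 : ∑ a, ∑ b, K a l i * J b j * g a b = ∑ a, ∑ b, J b j * K a i l * g a b :=
    Finset.sum_congr rfl fun a _ => Finset.sum_congr rfl fun b _ => by rw [hKs a l i]; ring
  have t7 : ∑ a, ∑ b, J b i * K a l j * g a b = ∑ a, ∑ b, J b i * K a j l * g a b := by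
    simp only [hKs _ l j]
  rw [t4, t5, t6, t7]
  ring

lemma sum_jacobian_inv_mul (h : IsIsometryOn ψ G' s' G s) (hz : z ∈ s') (e : Fin n)
    (W : Fin n → ℝ) :
    ∑ k, jacobian ψ e k z * ∑ l, (G' z)⁻¹ k l * ∑ c, jacobian ψ c l z * W c
      = ∑ c, (G (ψ z))⁻¹ e c * W c := by
  simp only [← h.sum_jacobian_inv hz e, Finset.mul_sum, Finset.sum_mul]
  symm
  refine Finset.sum_comm.trans (Finset.sum_congr rfl fun k _ => ?_)
  refine Finset.sum_comm.trans (Finset.sum_congr rfl fun l _ => ?_)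
  exact Finset.sum_congr rfl fun c _ => by ring

/-- The transformation law of the Christoffel symbols. -/
lemma sum_jacobian_christoffel (h : IsIsometryOn ψ G' s' G s) (hz : z ∈ s') (e i j : Fin n) :
    ∑ k, jacobian ψ e k z * christoffel G' k i j z = pd i (jacobian ψ e j) z
      + ∑ a, ∑ b, jacobian ψ a i z * jacobian ψ b j z * christoffel G e a b (ψ z) := by
  simp only [christoffel_eq_low, h.low_eq hz, mul_left_comm _ (1 / 2 : ℝ), ← Finset.mul_sum]
  rw [h.sum_jacobian_inv_mul hz]
  simp only [mul_add, Finset.sum_add_distrib]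
  congr 1
  · have : ∀ a, ∑ c, (G (ψ z))⁻¹ e c * (G (ψ z) c a * pd i (jacobian ψ a j) z)
        = (if e = a then 1 else 0) * pd i (jacobian ψ a j) z := fun a => by
      rw [← h.target.sum_inv_mul (h.mapsTo hz), Finset.sum_mul]
      exact Finset.sum_congr rfl fun c _ => by ring
    simp only [mul_left_comm _ (2 : ℝ), ← Finset.mul_sum]
    simp only [Finset.mul_sum]
    rw [Finset.sum_comm]
    simp only [← Finset.mul_sum, this]
    simp
  · congr 1
    simp only [Finset.mul_sum]
    rw [Finset.sum_comm]
    refine Finset.sum_congr rfl fun a _ => ?_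
    rw [Finset.sum_comm]
    exact Finset.sum_congr rfl fun b _ => Finset.sum_congr rfl fun c _ => by ring

/-- The chain rule leaves a term with second derivatives of `ψ`; it cancels against the
inhomogeneous term in the transformation law of the Christoffel symbols. -/
theorem hessian_comp (h : IsIsometryOn ψ G' s' G s) (hz : z ∈ s') (hu : ContDiffOn ℝ ∞ u s)
    (i j : Fin n) : hessian G' (fun w => u (ψ w)) i j z
      = ∑ a, ∑ b, jacobian ψ a i z * jacobian ψ b j z * hessian G u a b (ψ z) := by
  have ho := h.source.isOpen
  have su : ∀ a, ContDiffOn ℝ ∞ (pd a u) s := contDiffOn_pd h.target.isOpen hu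
  have dJ : ∀ a i, DifferentiableAt ℝ (jacobian ψ a i) z := fun a i =>
    differentiableAt_of_contDiffOn ho (h.smooth_jacobian a i) hz
  have du : ∀ a, DifferentiableAt ℝ (fun w => pd a u (ψ w)) z := fun a =>
    h.differentiableAt_comp hz (su a)
  have h2 : pd i (pd j fun w => u (ψ w)) z = ∑ b, pd i (jacobian ψ b j) z * pd b u (ψ z)
      + ∑ a, ∑ b, jacobian ψ a i z * jacobian ψ b j z * pd a (pd b u) (ψ z) := by
    rw [pd_congr ho (fun w hw => h.pd_comp hw hu j) hz, pd_sum _ fun b => (dJ b j).fun_mul (du b)]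
    rw [Finset.sum_comm (γ := Fin n), ← Finset.sum_add_distrib]
    refine Finset.sum_congr rfl fun b _ => ?_
    rw [pd_mul (dJ b j) (du b), h.pd_comp hz (su b), Finset.mul_sum]
    congr 1
    exact Finset.sum_congr rfl fun a _ => by ring
  have h3 : ∑ k, christoffel G' k i j z * pd k (fun w => u (ψ w)) z
      = ∑ e, (pd i (jacobian ψ e j) z
        + ∑ a, ∑ b, jacobian ψ a i z * jacobian ψ b j z * christoffel G e a b (ψ z))
          * pd e u (ψ z) := by
    simp only [h.pd_comp hz hu, ← h.sum_jacobian_christoffel hz, Finset.mul_sum, Finset.sum_mul]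
    rw [Finset.sum_comm]
    exact Finset.sum_congr rfl fun e _ => Finset.sum_congr rfl fun k _ => by ring
  have h4 : ∑ a, ∑ b, jacobian ψ a i z * jacobian ψ b j z * ∑ e, christoffel G e a b (ψ z)
        * pd e u (ψ z)
      = ∑ e, (∑ a, ∑ b, jacobian ψ a i z * jacobian ψ b j z * christoffel G e a b (ψ z))
          * pd e u (ψ z) := by
    simp only [Finset.mul_sum, Finset.sum_mul]
    refine (Finset.sum_congr rfl fun a _ => Finset.sum_comm).trans (Finset.sum_comm.trans ?_)
    exact Finset.sum_congr rfl fun e _ => Finset.sum_congr rfl fun a _ =>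
      Finset.sum_congr rfl fun b _ => by ring
  unfold hessian
  rw [h2, h3]
  simp only [mul_sub, Finset.sum_sub_distrib]
  rw [h4]
  simp only [add_mul, Finset.sum_add_distrib]
  ring

theorem laplacian_comp (h : IsIsometryOn ψ G' s' G s) (hz : z ∈ s') (hu : ContDiffOn ℝ ∞ u s) :
    laplacian G' (fun w => u (ψ w)) z = laplacian G u (ψ z) := by
  unfold laplacian
  simp only [h.hessian_comp hz hu]
  exact h.contract hz _

theorem normSq_comp (h : IsIsometryOn ψ G' s' G s) (hz : z ∈ s')
    (hτ : ∀ i j k, τ' i j k z = ∑ a, ∑ b, ∑ c,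
      jacobian ψ a i z * jacobian ψ b j z * jacobian ψ c k z * τ a b c (ψ z)) :
    normSq G' τ' z = normSq G τ (ψ z) := by
  set t : Fin n → Fin n → Fin n → ℝ := fun a b c => τ a b c (ψ z)
  -- `t₁` and `t₂` have one and two indices pulled back. Each of the three metric contractions then
  -- reduces to `contract_mul`, one index at a time.
  set t₁ : Fin n → Fin n → Fin n → ℝ := fun i b c => ∑ a, jacobian ψ a i z * t a b c with ht₁
  set t₂ : Fin n → Fin n → Fin n → ℝ := fun i j c => ∑ b, jacobian ψ b j z * t₁ i b c with ht₂
  have hτ' : ∀ i j k, τ' i j k z = ∑ c, jacobian ψ c k z * t₂ i j c := by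
    intro i j k
    rw [hτ]
    simp only [ht₁, ht₂, Finset.mul_sum]
    rw [show ∀ F : Fin n → Fin n → Fin n → ℝ, ∑ a, ∑ b, ∑ c, F a b c = ∑ c, ∑ b, ∑ a, F a b c from
      fun F => (Finset.sum_comm.trans (Finset.sum_congr rfl fun _ _ => Finset.sum_comm)).trans
        Finset.sum_comm]
    exact Finset.sum_congr rfl fun _ _ => Finset.sum_congr rfl fun _ _ =>
      Finset.sum_congr rfl fun _ _ => by ring
  have e1 : ∀ i j, torsionSq G' τ' i j z
      = ∑ p, ∑ q, (G (ψ z))⁻¹ p q * ∑ r, ∑ m, (G (ψ z))⁻¹ r m * (t₁ i r p * t₁ j m q) := by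
    intro i j
    rw [torsionSq_eq]
    simp only [hτ', h.contract_mul hz]
    have : ∀ p q, ∑ r, ∑ m, (G (ψ z))⁻¹ r m * (t₁ i r p * t₁ j m q)
        = ∑ a, ∑ c, (G' z)⁻¹ a c * (t₂ i a p * t₂ j c q) := fun p q =>
      (h.contract_mul hz _ _).symm
    simp only [this]
    exact sum_four_comm _ _ _
  have e2 : ∀ p q r m, ∑ i, ∑ j, (G' z)⁻¹ i j * (t₁ i r p * t₁ j m q)
      = ∑ a, ∑ b, (G (ψ z))⁻¹ a b * (t a r p * t b m q) := fun p q r m => h.contract_mul hz _ _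
  unfold normSq
  simp only [e1]
  refine (sum_four_comm _ _ _).trans ?_
  have e3 : ∀ p q, ∑ i, ∑ j, (G' z)⁻¹ i j * ∑ r, ∑ m, (G (ψ z))⁻¹ r m * (t₁ i r p * t₁ j m q)
      = ∑ i, ∑ j, (G (ψ z))⁻¹ i j * ∑ r, ∑ m, (G (ψ z))⁻¹ r m * (t i r p * t j m q) := by
    intro p q
    refine (sum_four_comm _ _ _).trans ?_
    simp only [e2]
    exact sum_four_comm _ _ _
  simp only [e3]
  refine (sum_four_comm _ _ _).trans ?_
  refine Finset.sum_congr rfl fun i _ => Finset.sum_congr rfl fun j _ => ?_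
  rw [torsionSq_eq]
  congr 1
  exact sum_four_comm _ _ _

theorem solitonPotential_comp (h : IsIsometryOn ψ G' s' G s) (hz : z ∈ s')
    (hu : ContDiffOn ℝ ∞ u s) (hτ : ∀ i j k, τ' i j k z = ∑ a, ∑ b, ∑ c,
      jacobian ψ a i z * jacobian ψ b j z * jacobian ψ c k z * τ a b c (ψ z)) :
    solitonPotential G' τ' (fun w => u (ψ w)) z = solitonPotential G τ u (ψ z) := by
  unfold solitonPotential
  rw [h.laplacian_comp hz hu, h.gradSq_comp hz hu, h.normSq_comp hz hτ]

/-- Coordinates in which the second derivatives cancel the Christoffel symbols are normal. -/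
theorem isNormalAt (h : IsIsometryOn ψ G' s' G s) (hz : z ∈ s') (h1 : G' z = 1)
    (h2 : ∀ e i j, pd i (jacobian ψ e j) z
      = - ∑ a, ∑ b, jacobian ψ a i z * jacobian ψ b j z * christoffel G e a b (ψ z)) :
    IsNormalAt G' z := by
  have hlow : ∀ l i j, christoffelLow G' l i j z = 0 := by
    intro l i j
    rw [h.low_eq hz]
    refine Finset.sum_eq_zero fun c _ => ?_
    refine mul_eq_zero_of_right _ ?_
    have e : ∀ a b, 2 * ∑ k, G (ψ z) c k * christoffel G k a b (ψ z)
        = christoffelLow G c a b (ψ z) := by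
      intro a b
      have : ∀ l, ∑ k, 2 * (G (ψ z) c k * (1 / 2 * ((G (ψ z))⁻¹ k l * christoffelLow G l a b (ψ z))))
          = (if c = l then 1 else 0) * christoffelLow G l a b (ψ z) := fun l => by
        rw [← h.target.sum_mul_inv (h.mapsTo hz), Finset.sum_mul]
        exact Finset.sum_congr rfl fun k _ => by ring
      simp only [christoffel_eq_low, Finset.mul_sum]
      rw [Finset.sum_comm, Finset.sum_congr rfl fun l _ => this l]
      simp
    simp only [h2, ← e, Finset.mul_sum, mul_neg, Finset.sum_neg_distrib]
    rw [neg_add_eq_zero]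
    refine Finset.sum_comm.trans (Finset.sum_congr rfl fun a _ => ?_)
    refine Finset.sum_comm.trans (Finset.sum_congr rfl fun b _ => ?_)
    exact Finset.sum_congr rfl fun k _ => by ring
  refine ⟨h1, fun k i j => ?_⟩
  -- In the sum of these two lowered symbols everything cancels except `2 ∂_k g_{ij}`.
  have e1 := hlow i k j
  have e2 := hlow j k i
  have hsym : ∀ l i j, pd l (fun w => G' w i j) z = pd l (fun w => G' w j i) z := fun l i j =>
    pd_congr h.source.isOpen (fun w hw => h.source.symm hw i j) hz l
  unfold christoffelLow at e1 e2
  have := pd_congr h.source.isOpen (fun w hw => h.source.symm hw j i) hz k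
  linarith

end IsIsometryOn

/-! ### The strong maximum principle -/

section MaximumPrinciple

variable {s : Set (Coord n)} {z : Coord n} {u : Coord n → ℝ}

/-- Used twice: to write a second order operator as a sum of second directional derivatives, and to
find a frame that is orthonormal at a point. -/
lemma exists_eq_transpose_mul_self {A : Matrix (Fin n) (Fin n) ℝ} (hA : A.PosSemidef) :
    ∃ B : Matrix (Fin n) (Fin n) ℝ, A = B.transpose * B := by
  open scoped MatrixOrder in
  obtain ⟨B, hB⟩ := CStarAlgebra.nonneg_iff_eq_star_mul_self.mp hA.nonneg
  exact ⟨B, by rw [hB, Matrix.star_eq_conjTranspose, Matrix.conjTranspose_eq_transpose_of_trivial]⟩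

lemma hasDerivAt_line (v : Coord n) (t : ℝ) (hu : DifferentiableAt ℝ u (z + t • v)) :
    HasDerivAt (fun t : ℝ => u (z + t • v)) (∑ i, v i * pd i u (z + t • v)) t := by
  rw [← fderiv_eq_sum_pd]
  have h1 : HasDerivAt (fun t : ℝ => z + t • v) v t := by
    simpa using ((hasDerivAt_id t).smul_const v).const_add z
  exact hu.hasFDerivAt.comp_hasDerivAt t h1

lemma pd_eq_zero_of_isLocalMax (h : IsLocalMax u z) (i : Fin n) : pd i u z = 0 := by
  simp [pd, h.fderiv_eq_zero]

/-- The Hessian matrix at a local maximum is negative semidefinite. -/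
lemma sum_pd_pd_nonpos (hs : IsOpen s) (hu : ContDiffOn ℝ ∞ u s) (hz : z ∈ s)
    (h : IsLocalMax u z) (v : Coord n) : ∑ i, ∑ j, v i * v j * pd i (pd j u) z ≤ 0 := by
  by_contra! hpos
  have hc : Filter.Tendsto (fun t : ℝ => z + t • v) (𝓝 0) (𝓝 z) := by
    have : Continuous fun t : ℝ => z + t • v := by fun_prop
    simpa using this.tendsto 0
  have hd1 : ∀ᶠ t : ℝ in 𝓝 0, deriv (fun t : ℝ => u (z + t • v)) t
      = ∑ j, v j * pd j u (z + t • v) := by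
    filter_upwards [hc.eventually (hs.mem_nhds hz)] with t ht
    exact (hasDerivAt_line v t (differentiableAt_of_contDiffOn hs hu ht)).deriv
  have hd2 : deriv (deriv fun t : ℝ => u (z + t • v)) 0
      = ∑ i, ∑ j, v i * v j * pd i (pd j u) z := by
    have hdj : ∀ j, HasDerivAt (fun t : ℝ => pd j u (z + t • v))
        (∑ i, v i * pd i (pd j u) (z + (0 : ℝ) • v)) 0 := fun j =>
      hasDerivAt_line v 0 (differentiableAt_of_contDiffOn hs (contDiffOn_pd hs hu j) (by simpa))
    rw [Filter.EventuallyEq.deriv_eq hd1,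
      (HasDerivAt.fun_sum fun j _ => (hdj j).const_mul (v j)).deriv, Finset.sum_comm]
    simp only [zero_smul, add_zero, Finset.mul_sum]
    exact Finset.sum_congr rfl fun j _ => Finset.sum_congr rfl fun i _ => by ring
  have hmax : IsLocalMax (fun t : ℝ => u (z + t • v)) 0 := by
    have := hc.eventually h
    simpa [IsLocalMax, IsMaxFilter] using this
  -- A positive second derivative would make the local maximum also a local minimum; the function
  -- would be constant near 0, with zero second derivative.
  have hmin : IsLocalMin (fun t : ℝ => u (z + t • v)) 0 := by
    refine isLocalMin_of_deriv_deriv_pos (by rw [hd2]; exact hpos) hmax.deriv_eq_zero ?_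
    exact (hasDerivAt_line v 0
      (differentiableAt_of_contDiffOn hs hu (by simpa))).continuousAt
  have hconst : (fun t : ℝ => u (z + t • v)) =ᶠ[𝓝 0] fun _ => u (z + (0 : ℝ) • v) := by
    filter_upwards [hmax, hmin] with t h1 h2 using le_antisymm h1 h2
  have h0 : deriv (deriv fun t : ℝ => u (z + t • v)) 0 = 0 := by
    rw [hconst.deriv.deriv_eq]
    simp
  rw [hd2] at h0
  exact hpos.ne' h0

/-- A linear second order operator `∑ a_{ij} ∂_i ∂_j u + ∑ b_i ∂_i u`. -/
def ellipticOp (A : Coord n → Matrix (Fin n) (Fin n) ℝ) (b : Fin n → Coord n → ℝ)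
    (u : Coord n → ℝ) (z : Coord n) : ℝ :=
  ∑ i, ∑ j, A z i j * pd i (pd j u) z + ∑ i, b i z * pd i u z

variable {A : Coord n → Matrix (Fin n) (Fin n) ℝ} {b : Fin n → Coord n → ℝ}

/-- With `A = Bᵀ B` the second order part is the sum over the rows of `B` of the Hessian evaluated
on that row; the first order part vanishes at a maximum. -/
lemma ellipticOp_nonpos (hs : IsOpen s) (hu : ContDiffOn ℝ ∞ u s) (hz : z ∈ s)
    (h : IsLocalMax u z) (hA : (A z).PosSemidef) : ellipticOp A b u z ≤ 0 := by
  obtain ⟨B, hB⟩ := exists_eq_transpose_mul_self hA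
  simp only [ellipticOp, pd_eq_zero_of_isLocalMax h, mul_zero, Finset.sum_const_zero, add_zero]
  have : ∑ i, ∑ j, A z i j * pd i (pd j u) z
      = ∑ k, ∑ i, ∑ j, B k i * B k j * pd i (pd j u) z := by
    simp only [hB, Matrix.mul_apply, Matrix.transpose_apply, Finset.sum_mul]
    exact (Finset.sum_congr rfl fun i _ => Finset.sum_comm).trans Finset.sum_comm
  rw [this]
  exact Finset.sum_nonpos fun k _ => sum_pd_pd_nonpos hs hu hz h (WithLp.toLp 2 (B k))

/-- The barrier `exp (-c |z - q|²)`. -/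
def barrier (c : ℝ) (q z : Coord n) : ℝ := Real.exp (-c * ∑ k, (z k - q k) ^ 2)

lemma contDiff_coord (k : Fin n) : ContDiff ℝ ∞ fun z : Coord n => z k :=
  (EuclideanSpace.proj (𝕜 := ℝ) k).contDiff

lemma pd_coord (i k : Fin n) (z : Coord n) : pd i (fun z : Coord n => z k) z
    = if k = i then 1 else 0 := by
  have := (EuclideanSpace.proj (𝕜 := ℝ) (ι := Fin n) k).hasFDerivAt (x := z) |>.fderiv
  unfold pd
  rw [show (fun z : Coord n => z k) = (EuclideanSpace.proj (𝕜 := ℝ) k) from rfl, this]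
  simp [basisVec]

lemma contDiff_barrier (c : ℝ) (q : Coord n) : ContDiff ℝ ∞ (barrier c q) := by
  unfold barrier
  have := fun k : Fin n => contDiff_coord k
  fun_prop

lemma pd_barrier (c : ℝ) (q z : Coord n) (i : Fin n) :
    pd i (barrier c q) z = -2 * c * ((z i - q i) * barrier c q z) := by
  have hd : ∀ k, DifferentiableAt ℝ (fun z : Coord n => z k - q k) z := fun k =>
    ((contDiff_coord k).differentiable (by simp) z).sub_const _
  have hS : pd i (fun z : Coord n => ∑ k, (z k - q k) ^ 2) z = 2 * (z i - q i) := by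
    simp only [pow_two]
    rw [pd_sum _ fun k => (hd k).fun_mul (hd k)]
    have : ∀ k, pd i (fun z : Coord n => z k - q k) z = if k = i then 1 else 0 := fun k => by
      rw [pd_sub ((contDiff_coord k).differentiable (by simp) z) (differentiableAt_const _),
        pd_coord, pd_const, sub_zero]
    simp only [fun k => pd_mul (hd k) (hd k) i, this]
    simp [Finset.sum_add_distrib]
    ring
  have hSd : DifferentiableAt ℝ (fun z : Coord n => ∑ k, (z k - q k) ^ 2) z :=
    DifferentiableAt.fun_sum fun k _ => (hd k).pow 2
  have h := (hSd.hasFDerivAt.const_mul (-c)).exp.fderiv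
  unfold pd at hS ⊢
  unfold barrier
  rw [h]
  simp only [FunLike.coe_smul, Pi.smul_apply, smul_eq_mul, hS]
  ring

lemma pd_pd_barrier (c : ℝ) (q z : Coord n) (i j : Fin n) :
    pd i (pd j (barrier c q)) z = barrier c q z *
      (4 * c ^ 2 * ((z i - q i) * (z j - q j)) - 2 * c * if j = i then 1 else 0) := by
  have hb : DifferentiableAt ℝ (barrier c q) z := (contDiff_barrier c q).differentiable (by simp) z
  have hd : DifferentiableAt ℝ (fun z : Coord n => z j - q j) z :=
    ((contDiff_coord j).differentiable (by simp) z).sub_const _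
  rw [show pd j (barrier c q) = fun z => -2 * c * ((z j - q j) * barrier c q z) from
    funext fun z => pd_barrier c q z j, pd_const_mul (hd.fun_mul hb), pd_mul hd hb,
    pd_sub ((contDiff_coord j).differentiable (by simp) z) (differentiableAt_const _),
    pd_coord, pd_const, pd_barrier]
  ring

/-- The quadratic form of `A` at `z - q` comes with `c²` and the rest with `c`; where the form is
bounded below by a positive constant and the rest is bounded, a large `c` makes the result positive.
-/
lemma ellipticOp_barrier (c : ℝ) (q z : Coord n) : ellipticOp A b (barrier c q) z
    = barrier c q z * (2 * c * (2 * c * ∑ i, ∑ j, A z i j * ((z i - q i) * (z j - q j))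
      - (∑ i, A z i i + ∑ i, b i z * (z i - q i)))) := by
  unfold ellipticOp
  simp only [pd_pd_barrier, pd_barrier]
  have h1 : ∑ i, ∑ j, A z i j * (barrier c q z *
      (4 * c ^ 2 * ((z i - q i) * (z j - q j)) - 2 * c * if j = i then 1 else 0))
      = barrier c q z * (4 * c ^ 2 * ∑ i, ∑ j, A z i j * ((z i - q i) * (z j - q j))
        - 2 * c * ∑ i, A z i i) := by
    have : ∀ i, A z i i = ∑ j, A z i j * if j = i then 1 else 0 := fun i => by simp
    simp only [this, Finset.mul_sum, ← Finset.sum_sub_distrib]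
    exact Finset.sum_congr rfl fun i _ => Finset.sum_congr rfl fun j _ => by ring
  have h2 : ∑ i, b i z * (-2 * c * ((z i - q i) * barrier c q z))
      = -2 * c * barrier c q z * ∑ i, b i z * (z i - q i) := by
    rw [Finset.mul_sum]
    exact Finset.sum_congr rfl fun i _ => by ring
  rw [h1, h2]
  ring

lemma barrier_eq (c : ℝ) (q z : Coord n) : barrier c q z = Real.exp (-c * dist z q ^ 2) := by
  unfold barrier
  rw [dist_eq_norm, EuclideanSpace.real_norm_sq_eq]
  simp

lemma ellipticOp_add {v : Coord n → ℝ} (hs : IsOpen s) (hu : ContDiffOn ℝ ∞ u s)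
    (hv : ContDiffOn ℝ ∞ v s) (hz : z ∈ s) (ε : ℝ) :
    ellipticOp A b (fun w => u w + ε * v w) z = ellipticOp A b u z + ε * ellipticOp A b v z := by
  have d : ∀ {v : Coord n → ℝ} {z}, z ∈ s → ContDiffOn ℝ ∞ v s → DifferentiableAt ℝ v z :=
    fun hz hv => differentiableAt_of_contDiffOn hs hv hz
  have h1 : ∀ z ∈ s, ∀ i, pd i (fun w => u w + ε * v w) z = pd i u z + ε * pd i v z := by
    intro z hz i
    rw [pd_add (d hz hu) (d hz (contDiffOn_const.mul hv)), pd_const_mul (d hz hv)]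
  have h2 : ∀ i j, pd i (pd j fun w => u w + ε * v w) z
      = pd i (pd j u) z + ε * pd i (pd j v) z := by
    intro i j
    have su := contDiffOn_pd hs hu j
    have sv := contDiffOn_pd hs hv j
    rw [pd_congr hs (fun w hw => h1 w hw j) hz, pd_add (d hz su) (d hz (contDiffOn_const.mul sv)),
      pd_const_mul (d hz sv)]
  unfold ellipticOp
  simp only [h1 z hz, h2, mul_add, Finset.sum_add_distrib, Finset.mul_sum]
  have e1 : ∀ i j, A z i j * (ε * pd i (pd j v) z) = ε * (A z i j * pd i (pd j v) z) :=
    fun i j => by ring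
  have e2 : ∀ i, b i z * (ε * pd i v z) = ε * (b i z * pd i v z) := fun i => by ring
  simp only [e1, e2]
  ring

/-- Hopf's lemma in the form needed for the strong maximum principle: `u` cannot touch its maximum
at exactly one point of a closed ball, on the boundary. -/
lemma not_touching (hs : IsOpen s) (hu : ContDiffOn ℝ ∞ u s)
    (hA : ∀ i j, ContinuousOn (fun z => A z i j) s) (hpos : ∀ z ∈ s, (A z).PosDef)
    (hb : ∀ i, ContinuousOn (b i) s) (hLu : ∀ z ∈ s, 0 ≤ ellipticOp A b u z)
    {q x : Coord n} (hx : x ∈ s) (hqx : q ≠ x) (hmax : ∀ z ∈ s, u z ≤ u x)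
    (hlt : ∀ z ∈ s, dist z q ≤ dist x q → z ≠ x → u z < u x) : False := by
  set R := dist x q with hR
  have hR0 : 0 < R := dist_pos.2 hqx.symm
  obtain ⟨r, hr0, hr⟩ := Metric.isOpen_iff.1 hs x hx
  -- The bound `r / 2` keeps the closed ball inside `s`, and `R / 2` keeps it away from `q`, where
  -- the quadratic form in `z - q` degenerates.
  set ρ := min (r / 2) (R / 2) with hρ
  have hρ0 : 0 < ρ := by positivity
  have hρR : ρ < R := (min_le_right _ _).trans_lt (by linarith)
  have hsub : Metric.closedBall x ρ ⊆ s := fun z hz =>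
    hr (Metric.mem_ball.2 ((Metric.mem_closedBall.1 hz).trans_lt
      ((min_le_left _ _).trans_lt (by linarith))))
  have hK : IsCompact (Metric.closedBall x ρ) := isCompact_closedBall x ρ
  have hcoord : ∀ k : Fin n, Continuous fun z : Coord n => z k := fun k =>
    (contDiff_coord k).continuous
  -- lower bound for the quadratic form
  obtain ⟨m, hm0, hm⟩ : ∃ m, 0 < m ∧ ∀ z ∈ Metric.closedBall x ρ,
      m ≤ ∑ i, ∑ j, A z i j * ((z i - q i) * (z j - q j)) := by
    refine hK.exists_forall_le' ?_ ?_
    · refine continuousOn_finsetSum _ fun i _ => continuousOn_finsetSum _ fun j _ => ?_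
      refine ((hA i j).mono hsub).mul ?_
      exact (((hcoord i).sub continuous_const).mul ((hcoord j).sub continuous_const)).continuousOn
    · intro z hz
      have hne : (fun k => z k - q k) ≠ 0 := by
        intro h0
        have : z = q := by
          ext k
          exact sub_eq_zero.1 (congrFun h0 k)
        rw [this, Metric.mem_closedBall, dist_comm] at hz
        linarith
      have := (hpos z (hsub hz)).dotProduct_mulVec_pos hne
      simp only [dotProduct, Matrix.mulVec, star_trivial, Finset.mul_sum] at this
      refine this.trans_eq ?_
      exact Finset.sum_congr rfl fun i _ => Finset.sum_congr rfl fun j _ => by ring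
  obtain ⟨C, hC⟩ := hK.exists_bound_of_continuousOn
    (f := fun z => ∑ i, A z i i + ∑ i, b i z * (z i - q i)) (by
      refine (continuousOn_finsetSum _ fun i _ => (hA i i).mono hsub).add
        (continuousOn_finsetSum _ fun i _ => ((hb i).mono hsub).mul ?_)
      exact ((hcoord i).sub continuous_const).continuousOn)
  -- Chosen so that `c` times the quadratic form is at least `|C| + 1`, which exceeds the trace and
  -- drift terms bounded by `C`.
  set c := (|C| + 1) / m with hc
  have hc0 : 0 < c := by positivity
  have hLb : ∀ z ∈ Metric.closedBall x ρ, 0 < ellipticOp A b (barrier c q) z := by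
    intro z hz
    rw [ellipticOp_barrier]
    refine mul_pos (Real.exp_pos _) (mul_pos (by positivity) ?_)
    have h1 := (le_abs_self _).trans ((hC z hz).trans (le_abs_self C))
    have h2 : |C| + 1 ≤ c * ∑ i, ∑ j, A z i j * ((z i - q i) * (z j - q j)) :=
      calc |C| + 1 = c * m := by rw [hc]; field_simp
        _ ≤ _ := mul_le_mul_of_nonneg_left (hm z hz) hc0.le
    have h3 := abs_nonneg C
    linarith
  -- the comparison function
  have hcont : ContinuousOn u s := hu.continuousOn
  -- On the part of the small sphere inside the ball around `q`, `u` is below its maximum by a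
  -- uniform gap `M`.
  obtain ⟨M, hM, hMle⟩ : ∃ M, 0 < M ∧ ∀ z ∈ Metric.sphere x ρ ∩ Metric.closedBall q R,
      M ≤ u x - u z := by
    refine ((isCompact_sphere x ρ).inter_right Metric.isClosed_closedBall).exists_forall_le' ?_ ?_
    · exact continuousOn_const.sub (hcont.mono fun z hz => hsub (Metric.sphere_subset_closedBall hz.1))
    · rintro z ⟨hz1, hz2⟩
      have hzs := hsub (Metric.sphere_subset_closedBall hz1)
      refine sub_pos.2 (hlt z hzs hz2 ?_)
      rintro rfl
      simp at hz1
      exact hρ0.ne hz1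
  have hbx : barrier c q x = Real.exp (-c * R ^ 2) := barrier_eq c q x
  -- The weight `M / 2` keeps the maximum of `w` off the small sphere. Inside the ball around `q`
  -- the barrier is at most 1 and the gap wins; outside it the barrier is smaller than at `x` while
  -- `u ≤ u x`. At an interior maximum the operator would be nonpositive, but on `w` it is positive.
  set w : Coord n → ℝ := fun z => u z + (M / 2) * barrier c q z with hw
  have hwc : ContDiffOn ℝ ∞ w s := hu.add (contDiffOn_const.mul (contDiff_barrier c q).contDiffOn)
  obtain ⟨p, hp, hpmax⟩ := hK.exists_isMaxOn ⟨x, Metric.mem_closedBall_self hρ0.le⟩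
    (hwc.continuousOn.mono hsub)
  have hpx : w x ≤ w p := hpmax (Metric.mem_closedBall_self hρ0.le)
  have hpball : p ∈ Metric.ball x ρ := by
    rcases (Metric.mem_closedBall.1 hp).lt_or_eq with h | h
    · exact h
    exfalso
    by_cases hpq : dist p q ≤ R
    · have h1 := hMle p ⟨h, hpq⟩
      have h2 : barrier c q p ≤ 1 := by
        rw [barrier_eq]
        exact Real.exp_le_one_iff.2 (by nlinarith [sq_nonneg (dist p q)])
      have h3 : 0 < barrier c q x := Real.exp_pos _
      simp only [hw] at hpx
      nlinarith
    · push Not at hpq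
      have h1 := hmax p (hsub hp)
      have h2 : barrier c q p < barrier c q x := by
        rw [hbx, barrier_eq]
        refine Real.exp_lt_exp.2 ?_
        nlinarith [mul_pos hc0 (show 0 < dist p q ^ 2 - R ^ 2 by nlinarith)]
      simp only [hw] at hpx
      nlinarith
  have hloc : IsLocalMax w p := by
    filter_upwards [Metric.isOpen_ball.mem_nhds hpball] with z hz
    exact hpmax (Metric.ball_subset_closedBall hz)
  have h1 := ellipticOp_nonpos (b := b) hs hwc (hsub hp) hloc (hpos p (hsub hp)).posSemidef
  rw [hw, ellipticOp_add hs hu (contDiff_barrier c q).contDiffOn (hsub hp)] at h1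
  have h2 := hLu p (hsub hp)
  have h3 := hLb p hp
  nlinarith

/-- The strong maximum principle. -/
theorem eventually_eq_of_isMax (hs : IsOpen s) (hu : ContDiffOn ℝ ∞ u s)
    (hA : ∀ i j, ContinuousOn (fun z => A z i j) s) (hpos : ∀ z ∈ s, (A z).PosDef)
    (hb : ∀ i, ContinuousOn (b i) s) (hLu : ∀ z ∈ s, 0 ≤ ellipticOp A b u z)
    {y : Coord n} (hy : y ∈ s) (hmax : ∀ z ∈ s, u z ≤ u y) : ∀ᶠ z in 𝓝 y, u z = u y := by
  obtain ⟨r, hr0, hr⟩ := Metric.isOpen_iff.1 hs y hy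
  have hcont : ContinuousOn u s := hu.continuousOn
  -- With `q` within `r / 3` of `y`, every point as close to `q` as `y` is lies in the closed ball
  -- of radius `2 r / 3`, hence in `s`.
  refine Metric.eventually_nhds_iff.2 ⟨r / 3, by positivity, fun q hq => ?_⟩
  by_contra hne
  have hqs : q ∈ s := hr (Metric.mem_ball.2 (by linarith))
  have hsub : Metric.closedBall y (2 * r / 3) ⊆ s := fun z hz =>
    hr (Metric.mem_ball.2 ((Metric.mem_closedBall.1 hz).trans_lt (by linarith)))
  have hK : IsCompact (Metric.closedBall y (2 * r / 3) ∩ {z | u z = u y}) := by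
    have : Metric.closedBall y (2 * r / 3) ∩ {z | u z = u y}
        = Metric.closedBall y (2 * r / 3) ∩ u ⁻¹' {u y} := rfl
    rw [this]
    exact (isCompact_closedBall _ _).of_isClosed_subset
      ((hcont.mono hsub).preimage_isClosed_of_isClosed Metric.isClosed_closedBall
        isClosed_singleton) Set.inter_subset_left
  obtain ⟨x, ⟨hxb, hxu⟩, hxmin⟩ := hK.exists_isMinOn
    ⟨y, Metric.mem_closedBall_self (by positivity), rfl⟩
    (f := fun z => dist z q) (continuous_id.dist continuous_const).continuousOn
  have hxu : u x = u y := hxu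
  have hxy : dist x q ≤ dist y q :=
    hxmin ⟨Metric.mem_closedBall_self (by positivity), rfl⟩
  have hxq : x ≠ q := by rintro rfl; exact hne hxu
  -- The open ball around `q` through the nearest maximum point `x` contains no maximum point, but
  -- its boundary may contain several. The ball centred at the midpoint with half the radius meets
  -- that boundary only in `x`, as the barrier argument requires.
  set p := midpoint ℝ q x with hp
  have hpx : dist x p = dist x q / 2 := by
    rw [hp, dist_right_midpoint (𝕜 := ℝ) , dist_comm q x]
    simp
    ring
  have hpq : dist p q = dist x q / 2 := by
    rw [hp, dist_midpoint_left (𝕜 := ℝ), dist_comm q x]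
    simp
    ring
  have hxq0 : 0 < dist x q := dist_pos.2 hxq
  refine not_touching hs hu hA hpos hb hLu (q := p) (hsub hxb) ?_ (fun z hz => hxu ▸ hmax z hz) ?_
  · intro h
    rw [← h, dist_self] at hpx
    linarith
  · intro z hz hzp hzx
    rw [hxu]
    refine (hmax z hz).lt_of_ne fun hzu => hzx ?_
    have hzq : dist z q ≤ dist x q := (dist_triangle z p q).trans (by linarith)
    have hzK : dist x q ≤ dist z q := by
      refine hxmin ⟨Metric.mem_closedBall.2 ?_, hzu⟩
      have := dist_triangle z q y
      rw [dist_comm y q] at hxy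
      linarith
    -- Equality in the triangle inequality for `z`, `p`, `q`: the parallelogram law turns it into `z
    -- - p = x - p`.
    have hpar := parallelogram_law_with_norm ℝ (z - p) (p - q)
    have hv : p - q = x - p := by
      rw [hp, midpoint_sub_left, right_sub_midpoint]
    rw [sub_add_sub_cancel, hv, ← dist_eq_norm z q, ← dist_eq_norm z p, ← dist_eq_norm x p,
      hpx] at hpar
    rw [hpx] at hzp
    have h0 : ‖z - p - (x - p)‖ ^ 2 ≤ 0 := by
      have e1 : dist z p ^ 2 ≤ (dist x q / 2) ^ 2 := pow_le_pow_left₀ dist_nonneg hzp 2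
      have e2 : dist x q ^ 2 ≤ dist z q ^ 2 := pow_le_pow_left₀ dist_nonneg hzK 2
      linarith
    have h1 : ‖z - p - (x - p)‖ = 0 := by nlinarith [norm_nonneg (z - p - (x - p))]
    rw [norm_eq_zero, sub_sub_sub_cancel_right, sub_eq_zero] at h1
    exact h1

/-- A solution of `α Δu = β |∇u|²` with `α > 0` that attains its maximum is locally constant. -/
theorem MetricOn.eventually_eq_of_isMax {G : Coord n → Matrix (Fin n) (Fin n) ℝ}
    (hG : MetricOn G s) (hu : ContDiffOn ℝ ∞ u s) {α β : ℝ} (hα : 0 < α)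
    (heq : ∀ z ∈ s, α * laplacian G u z - β * gradSq G u z = 0)
    {y : Coord n} (hy : y ∈ s) (hmax : ∀ z ∈ s, u z ≤ u y) : ∀ᶠ z in 𝓝 y, u z = u y := by
  -- The nonlinear term is absorbed in the drift: `|∇u|² = (g^{kj} ∂_j u) ∂_k u` is linear in `∂_k
  -- u` once the first factor is regarded as a given coefficient. The first summand comes from the
  -- Christoffel symbols in the Laplacian.
  set b : Fin n → Coord n → ℝ := fun k z =>
    - (∑ i, ∑ j, (G z)⁻¹ i j * christoffel G k i j z)
      - (β / α) * ∑ j, (G z)⁻¹ k j * pd j u z with hb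
  refine SkewTorsion.eventually_eq_of_isMax (A := fun z => (G z)⁻¹) (b := b) hG.isOpen hu
    (fun i j => (hG.smooth_inv i j).continuousOn) (fun z hz => (hG.posDef z hz).inv)
    (fun k => ?_) (fun z hz => ?_) hy hmax
  · have : ContDiffOn ℝ ∞ (b k) s := by
      refine ((ContDiffOn.sum fun i _ => ContDiffOn.sum fun j _ =>
        (hG.smooth_inv i j).mul (hG.smooth_christoffel k i j)).neg).sub
        (contDiffOn_const.mul (ContDiffOn.sum fun j _ => (hG.smooth_inv k j).mul
          (contDiffOn_pd hG.isOpen hu j)))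
    exact this.continuousOn
  · have h : ellipticOp (fun z => (G z)⁻¹) b u z
        = laplacian G u z - (β / α) * gradSq G u z := by
      unfold ellipticOp laplacian gradSq hessian
      simp only [hb, sub_mul, neg_mul, Finset.sum_sub_distrib, Finset.sum_neg_distrib, mul_sub]
      have e1 : ∑ k, (∑ i, ∑ j, (G z)⁻¹ i j * christoffel G k i j z) * pd k u z
          = ∑ i, ∑ j, (G z)⁻¹ i j * ∑ k, christoffel G k i j z * pd k u z := by
        simp only [Finset.sum_mul, Finset.mul_sum]
        refine Finset.sum_comm.trans (Finset.sum_congr rfl fun i _ => ?_)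
        refine Finset.sum_comm.trans (Finset.sum_congr rfl fun j _ => ?_)
        exact Finset.sum_congr rfl fun k _ => by ring
      have e2 : ∑ k, β / α * (∑ j, (G z)⁻¹ k j * pd j u z) * pd k u z
          = β / α * ∑ i, ∑ j, (G z)⁻¹ i j * (pd i u z * pd j u z) := by
        simp only [Finset.mul_sum, Finset.sum_mul]
        exact Finset.sum_congr rfl fun i _ => Finset.sum_congr rfl fun j _ => by ring
      rw [e1, e2]
      ring
    rw [h]
    have := heq z hz
    refine le_of_eq ?_
    field_simp
    linarith

end MaximumPrinciple

/-! ### The Ricci tensor of a connection with skew torsion -/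

section TorsionRicci

variable {G : Coord n → Matrix (Fin n) (Fin n) ℝ} {s : Set (Coord n)} {y : Coord n}
  {u : Coord n → ℝ} {τ : Fin n → Fin n → Fin n → Coord n → ℝ}

lemma MetricOn.christoffel_symm (hG : MetricOn G s) (hy : y ∈ s) (k i j : Fin n) :
    christoffel G k i j y = christoffel G k j i y := by
  unfold christoffel
  congr 1
  refine Finset.sum_congr rfl fun l _ => ?_
  rw [pd_congr hG.isOpen (fun w hw => hG.symm hw i j) hy l]
  ring

lemma MetricOn.sum_inv_mul_antisymm (hG : MetricOn G s) (hy : y ∈ s) {X : Fin n → Fin n → ℝ}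
    (hX : ∀ i j, X i j = - X j i) : ∑ i, ∑ j, (G y)⁻¹ i j * X i j = 0 := by
  have h : ∑ i, ∑ j, (G y)⁻¹ i j * X i j = - ∑ i, ∑ j, (G y)⁻¹ i j * X i j := by
    conv_lhs => rw [Finset.sum_comm]
    simp only [← Finset.sum_neg_distrib]
    refine Finset.sum_congr rfl fun i _ => Finset.sum_congr rfl fun j _ => ?_
    rw [hX j i, hG.inv_symm hy]
    ring
  linarith

/-- The inverse metric is parallel. -/
lemma MetricOn.pd_inv (hG : MetricOn G s) (hy : y ∈ s) (l a b : Fin n) :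
    pd l (fun z => (G z)⁻¹ a b) y = - ∑ m, (christoffel G a l m y * (G y)⁻¹ m b
      + christoffel G b l m y * (G y)⁻¹ a m) := by
  have dG : ∀ a b, DifferentiableAt ℝ (fun z => G z a b) y := fun a b =>
    differentiableAt_of_contDiffOn hG.isOpen (hG.smooth a b) hy
  have dI : ∀ a b, DifferentiableAt ℝ (fun z => (G z)⁻¹ a b) y := fun a b =>
    differentiableAt_of_contDiffOn hG.isOpen (hG.smooth_inv a b) hy
  -- Differentiation of `G⁻¹ G = 1`; `h3` then expresses `∂G` by lowered Christoffel symbols.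
  have h1 : ∀ j, ∑ i, pd l (fun z => (G z)⁻¹ a i) y * G y i j
      = - ∑ i, (G y)⁻¹ a i * pd l (fun z => G z i j) y := fun j => by
    have h := pd_congr hG.isOpen (fun z hz => hG.sum_inv_mul hz a j) hy l
    rw [pd_const, pd_sum _ (fun i => (dI a i).fun_mul (dG i j)),
      Finset.sum_congr rfl fun i _ => pd_mul (dI a i) (dG i j) l, Finset.sum_add_distrib] at h
    linarith
  have h2 : pd l (fun z => (G z)⁻¹ a b) y
      = ∑ j, (∑ i, pd l (fun z => (G z)⁻¹ a i) y * G y i j) * (G y)⁻¹ j b := by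
    have : ∀ i, ∑ j, pd l (fun z => (G z)⁻¹ a i) y * G y i j * (G y)⁻¹ j b
        = pd l (fun z => (G z)⁻¹ a i) y * if i = b then 1 else 0 := fun i => by
      rw [← hG.sum_mul_inv hy, Finset.mul_sum]
      exact Finset.sum_congr rfl fun j _ => by ring
    simp only [Finset.sum_mul]
    rw [Finset.sum_comm]
    simp [this]
  have h3 : ∀ i j, pd l (fun z => G z i j) y
      = (1 / 2) * (christoffelLow G j l i y + christoffelLow G i l j y) := fun i j => by
    unfold christoffelLow
    rw [pd_congr hG.isOpen (fun w hw => hG.symm hw j i) hy l]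
    ring
  rw [h2]
  simp only [h1, h3, neg_mul, Finset.sum_neg_distrib, Finset.sum_add_distrib]
  congr 1
  have e1 : ∑ m, christoffel G a l m y * (G y)⁻¹ m b
      = ∑ j, ∑ i, (G y)⁻¹ a i * (1 / 2 * christoffelLow G i l j y) * (G y)⁻¹ j b := by
    simp only [christoffel_eq_low, Finset.mul_sum, Finset.sum_mul]
    exact Finset.sum_congr rfl fun j _ => Finset.sum_congr rfl fun i _ => by ring
  have e2 : ∑ m, christoffel G b l m y * (G y)⁻¹ a m
      = ∑ j, ∑ i, (G y)⁻¹ a i * (1 / 2 * christoffelLow G j l i y) * (G y)⁻¹ j b := by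
    simp only [christoffel_eq_low, Finset.mul_sum, Finset.sum_mul]
    rw [Finset.sum_comm]
    refine Finset.sum_congr rfl fun j _ => Finset.sum_congr rfl fun i _ => ?_
    rw [hG.inv_symm hy b j]
    ring
  rw [e1, e2, ← Finset.sum_add_distrib]
  refine Finset.sum_congr rfl fun j _ => ?_
  rw [← Finset.sum_add_distrib, Finset.sum_mul]
  exact Finset.sum_congr rfl fun i _ => by ring

lemma IsAlternating.rotate (hτ : IsAlternating τ) (i j k : Fin n) (z : Coord n) :
    τ i j k z = τ k i j z := by
  rw [hτ.swap_right, hτ.swap_left, neg_neg]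

/-- `Ric = Ric^g - ¼ T² - ½ δT`. -/
theorem MetricOn.ricci_torsionCoeff (hG : MetricOn G s) (hy : y ∈ s)
    (hτs : ∀ i j k, ContDiffOn ℝ ∞ (τ i j k) s) (hτ : IsAlternating τ) (j k : Fin n) :
    ricci (torsionCoeff G τ) j k y = ricci (christoffel G) j k y
      - (1 / 4) * torsionSq G τ j k y - (1 / 2) * codiff G τ j k y := by
  have ho := hG.isOpen
  set K : Fin n → Fin n → Fin n → Coord n → ℝ := fun k i j z => ∑ l, (G z)⁻¹ k l * τ i j l z with hK
  have sK : ∀ k i j, ContDiffOn ℝ ∞ (K k i j) s := fun k i j =>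
    ContDiffOn.sum fun l _ => (hG.smooth_inv k l).mul (hτs i j l)
  have dK : ∀ k i j, DifferentiableAt ℝ (K k i j) y := fun k i j =>
    differentiableAt_of_contDiffOn ho (sK k i j) hy
  have dΓ : ∀ k i j, DifferentiableAt ℝ (christoffel G k i j) y := fun k i j =>
    differentiableAt_of_contDiffOn ho (hG.smooth_christoffel k i j) hy
  have hA : ∀ k i j z, torsionCoeff G τ k i j z = christoffel G k i j z + (1 / 2) * K k i j z :=
    fun _ _ _ _ => rfl
  have hpA : ∀ l k i j, pd l (torsionCoeff G τ k i j) y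
      = pd l (christoffel G k i j) y + (1 / 2) * pd l (K k i j) y := fun l k i j => by
    rw [← pd_const_mul (dK k i j), ← pd_add (dΓ k i j) ((dK k i j).const_mul _)]
    rfl
  -- The trace of the torsion part vanishes by skew symmetry; this removes its derivative and every
  -- quadratic term containing that trace.
  have htr : ∀ z ∈ s, ∀ k, ∑ i, K i i k z = 0 := fun z hz k => by
    refine hG.sum_inv_mul_antisymm hz fun i m => ?_
    rw [hτ.rotate i k m, hτ.swap_left, hτ.rotate m k i, hτ.swap_left i m k, neg_neg]
  have hptr : ∑ i, pd j (K i i k) y = 0 := by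
    rw [← pd_sum _ fun i => dK i i k, pd_congr ho (fun z hz => htr z hz k) hy, pd_const]
  have hKK : ∑ i, ∑ m, K i j m y * K m i k y = torsionSq G τ j k y := by
    unfold torsionSq
    simp only [hK, Finset.sum_mul_sum]
    have : ∀ f : Fin n → Fin n → Fin n → Fin n → ℝ, ∑ i, ∑ m, ∑ p, ∑ q, f i m p q
        = ∑ m, ∑ p, ∑ q, ∑ i, f i m p q := fun f =>
      Finset.sum_comm.trans <| Finset.sum_congr rfl fun _ _ =>
        Finset.sum_comm.trans <| Finset.sum_congr rfl fun _ _ => Finset.sum_comm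
    rw [this]
    refine Finset.sum_congr rfl fun m _ => Finset.sum_congr rfl fun p _ =>
      Finset.sum_congr rfl fun q _ => Finset.sum_congr rfl fun i _ => ?_
    rw [hG.inv_symm hy i p, ← hτ.rotate k q i]
    ring
  -- Differentiating the raised index gives, because the inverse metric is parallel, Christoffel
  -- terms. Together with the mixed terms in `hexp` they complete the partial divergence to the
  -- covariant one, that is to `-δτ`.
  have hdiv : ∑ i, pd i (K i j k) y = ∑ i, ∑ a, (G y)⁻¹ i a * pd i (τ a j k) y
      - ∑ i, ∑ m, christoffel G i i m y * K m j k y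
      - ∑ i, ∑ m, ∑ a, (G y)⁻¹ i a * (christoffel G m i a y * τ m j k y) := by
    have hp : ∀ i, pd i (K i j k) y = ∑ a, (pd i (fun z => (G z)⁻¹ i a) y * τ a j k y
        + (G y)⁻¹ i a * pd i (τ a j k) y) := fun i => by
      have hfun : K i j k = fun z => ∑ a, (G z)⁻¹ i a * τ a j k z :=
        funext fun z => Finset.sum_congr rfl fun a _ => by rw [hτ.rotate j k a]
      have dI : ∀ a b, DifferentiableAt ℝ (fun z => (G z)⁻¹ a b) y := fun a b =>
        differentiableAt_of_contDiffOn ho (hG.smooth_inv a b) hy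
      have dτ : ∀ i j k, DifferentiableAt ℝ (τ i j k) y := fun i j k =>
        differentiableAt_of_contDiffOn ho (hτs i j k) hy
      rw [hfun, pd_sum _ fun a => (dI i a).fun_mul (dτ a j k)]
      exact Finset.sum_congr rfl fun a _ => pd_mul (dI i a) (dτ a j k) i
    have hpi : ∀ i, ∑ a, pd i (fun z => (G z)⁻¹ i a) y * τ a j k y
        = - ∑ m, christoffel G i i m y * K m j k y
          - ∑ m, ∑ a, (G y)⁻¹ i a * (christoffel G m i a y * τ m j k y) := fun i => by
      simp only [hG.pd_inv hy, hK, neg_mul, Finset.sum_neg_distrib, Finset.sum_add_distrib,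
        add_mul, Finset.sum_mul, Finset.mul_sum]
      rw [neg_add']
      congr 1
      · rw [neg_inj, Finset.sum_comm]
        refine Finset.sum_congr rfl fun m _ => Finset.sum_congr rfl fun a _ => ?_
        rw [hτ.rotate j k a]
        ring
      · exact Finset.sum_congr rfl fun m _ => Finset.sum_congr rfl fun a _ => by ring
    simp only [hp, Finset.sum_add_distrib, hpi, Finset.sum_sub_distrib, Finset.sum_neg_distrib]
    ring
  have hc1 : ∑ i, ∑ m, christoffel G i j m y * K m i k y
      = ∑ i, ∑ a, ∑ m, (G y)⁻¹ i a * (christoffel G m i j y * τ a m k y) := by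
    simp only [hK, Finset.mul_sum]
    rw [Finset.sum_comm]
    refine Finset.sum_congr rfl fun m _ => ?_
    rw [Finset.sum_comm]
    refine Finset.sum_congr rfl fun a _ => Finset.sum_congr rfl fun i _ => ?_
    rw [hτ.rotate i k a, hG.christoffel_symm hy i j m]
    ring
  have hc2 : ∑ i, ∑ m, K i j m y * christoffel G m i k y
      = ∑ i, ∑ a, ∑ m, (G y)⁻¹ i a * (christoffel G m i k y * τ a j m y) := by
    simp only [hK, Finset.sum_mul]
    refine Finset.sum_congr rfl fun i _ => ?_
    rw [Finset.sum_comm]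
    refine Finset.sum_congr rfl fun a _ => Finset.sum_congr rfl fun m _ => ?_
    rw [hτ.rotate j m a]
    ring
  have hcod : codiff G τ j k y = - (∑ i, ∑ a, (G y)⁻¹ i a * pd i (τ a j k) y
      - ∑ i, ∑ a, ∑ m, (G y)⁻¹ i a * (christoffel G m i a y * τ m j k y)
      - ∑ i, ∑ a, ∑ m, (G y)⁻¹ i a * (christoffel G m i j y * τ a m k y)
      - ∑ i, ∑ a, ∑ m, (G y)⁻¹ i a * (christoffel G m i k y * τ a j m y)) := by
    unfold codiff covDeriv
    simp only [Finset.mul_sum, mul_sub, mul_add, Finset.sum_add_distrib, Finset.sum_sub_distrib]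
    ring
  have hswap : ∑ i, ∑ a, ∑ m, (G y)⁻¹ i a * (christoffel G m i a y * τ m j k y)
      = ∑ i, ∑ m, ∑ a, (G y)⁻¹ i a * (christoffel G m i a y * τ m j k y) :=
    Finset.sum_congr rfl fun i _ => Finset.sum_comm
  have htr2 : ∑ i, ∑ m, K i i m y * christoffel G m j k y = 0 := by
    rw [Finset.sum_comm]
    exact Finset.sum_eq_zero fun m _ => by rw [← Finset.sum_mul, htr y hy, zero_mul]
  have htr3 : ∑ i, ∑ m, K i i m y * K m j k y = 0 := by
    rw [Finset.sum_comm]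
    exact Finset.sum_eq_zero fun m _ => by rw [← Finset.sum_mul, htr y hy, zero_mul]
  have hexp : ricci (torsionCoeff G τ) j k y = ricci (christoffel G) j k y
      + (1 / 2) * ∑ i, pd i (K i j k) y - (1 / 2) * ∑ i, pd j (K i i k) y
      + (1 / 2) * ∑ i, ∑ m, christoffel G i i m y * K m j k y
      + (1 / 2) * ∑ i, ∑ m, K i i m y * christoffel G m j k y
      + (1 / 4) * ∑ i, ∑ m, K i i m y * K m j k y
      - (1 / 2) * ∑ i, ∑ m, christoffel G i j m y * K m i k y
      - (1 / 2) * ∑ i, ∑ m, K i j m y * christoffel G m i k y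
      - (1 / 4) * ∑ i, ∑ m, K i j m y * K m i k y := by
    unfold ricci curvature
    simp only [hpA, hA, Finset.mul_sum, ← Finset.sum_add_distrib, ← Finset.sum_sub_distrib]
    refine Finset.sum_congr rfl fun i _ => ?_
    have : ∀ m, (christoffel G i i m y + 1 / 2 * K i i m y)
          * (christoffel G m j k y + 1 / 2 * K m j k y)
        - (christoffel G i j m y + 1 / 2 * K i j m y) * (christoffel G m i k y + 1 / 2 * K m i k y)
      = (christoffel G i i m y * christoffel G m j k y - christoffel G i j m y * christoffel G m i k y)
        + 1 / 2 * (christoffel G i i m y * K m j k y) + 1 / 2 * (K i i m y * christoffel G m j k y)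
        + 1 / 4 * (K i i m y * K m j k y) - 1 / 2 * (christoffel G i j m y * K m i k y)
        - 1 / 2 * (K i j m y * christoffel G m i k y) - 1 / 4 * (K i j m y * K m i k y) :=
      fun m => by ring
    simp only [this, Finset.sum_add_distrib, Finset.sum_sub_distrib]
    ring
  rw [hexp, hdiv, hptr, hKK, hc1, hc2, htr2, htr3, hcod, hswap]
  ring

lemma MetricOn.sum_inv_mul_gradInterior (hG : MetricOn G s) (hy : y ∈ s) (hτ : IsAlternating τ) :
    ∑ i, ∑ j, (G y)⁻¹ i j * gradInterior G τ u i j y = 0 := by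
  refine hG.sum_inv_mul_antisymm hy fun i j => ?_
  unfold gradInterior
  simp only [← Finset.sum_neg_distrib]
  refine Finset.sum_congr rfl fun a _ => Finset.sum_congr rfl fun b _ => ?_
  rw [hτ.swap_right a i j]
  ring

end TorsionRicci

/-! ### Tensor fields in charts -/

/-- The domain of the change of coordinates `φ ∘ φ'⁻¹`. -/
def overlap {M : Type*} [TopologicalSpace M] (φ φ' : OpenPartialHomeomorph M (Coord n)) :
    Set (Coord n) :=
  φ'.target ∩ φ'.symm ⁻¹' φ.source

lemma isOpen_overlap {M : Type*} [TopologicalSpace M]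
    (φ φ' : OpenPartialHomeomorph M (Coord n)) : IsOpen (overlap φ φ') :=
  φ'.isOpen_inter_preimage_symm φ.open_source

lemma overlap_swap_mem {M : Type*} [TopologicalSpace M]
    {φ φ' : OpenPartialHomeomorph M (Coord n)} {z : Coord n} (hz : z ∈ overlap φ φ') :
    φ (φ'.symm z) ∈ overlap φ' φ :=
  ⟨φ.map_source hz.2, by rw [Set.mem_preimage, φ.left_inv hz.2]; exact φ'.map_target hz.1⟩

/-- The bound holds on all of `M`, so the values of `φ.symm` off the target do no harm. -/
lemma isLocalMax_comp_symm {M : Type*} [TopologicalSpace M] {f : M → ℝ}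
    {φ : OpenPartialHomeomorph M (Coord n)} {x : M} (hx : x ∈ φ.source) (h : ∀ x', f x' ≤ f x) :
    IsLocalMax (f ∘ φ.symm) (φ x) :=
  Filter.Eventually.of_forall fun z => by simpa [φ.left_inv hx] using h (φ.symm z)

section Charts

variable {M : Type*} [TopologicalSpace M] [ChartedSpace (Coord n) M]
  {φ φ' : OpenPartialHomeomorph M (Coord n)} {y z : Coord n}

lemma IsChart.contMDiffOn (hφ : IsChart φ) : ContMDiffOn (𝓡 n) (𝓡 n) ∞ φ φ.source :=
  contMDiffOn_of_mem_maximalAtlas hφ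

lemma IsChart.contMDiffOn_symm (hφ : IsChart φ) : ContMDiffOn (𝓡 n) (𝓡 n) ∞ φ.symm φ.target :=
  contMDiffOn_symm_of_mem_maximalAtlas hφ

/-- The components of a differential in coordinates. -/
lemma fderiv_basisVec {ψ : Coord n → Coord n} (h : DifferentiableAt ℝ ψ z) (i : Fin n) :
    fderiv ℝ ψ z (basisVec i) = ∑ a, jacobian ψ a i z • basisVec a := by
  have hc : ∀ a, jacobian ψ a i z = fderiv ℝ ψ z (basisVec i) a := fun a => by
    have := ((EuclideanSpace.proj (𝕜 := ℝ) a).hasFDerivAt.comp z h.hasFDerivAt).fderiv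
    unfold jacobian pd
    rw [show (fun w => ψ w a) = (EuclideanSpace.proj (𝕜 := ℝ) a) ∘ ψ from rfl, this]
    rfl
  ext j
  simp [hc, basisVec, Pi.single_apply]

/-- A 3-form at a point, as a multilinear map on the model space. -/
def formAt (T : ThreeForm n M) (x : M) : Coord n [⋀^Fin 3]→L[ℝ] ℝ := T x

lemma formAt_sum_smul (T : ThreeForm n M) (x : M) (c d e : Fin n → ℝ) (v : Fin n → Coord n) :
    formAt T x ![∑ a, c a • v a, ∑ a, d a • v a, ∑ a, e a • v a]
      = ∑ a, ∑ b, ∑ k, c a * d b * e k * formAt T x ![v a, v b, v k] := by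
  let B := (formAt T x).toMultilinearMap
  change B _ = ∑ a, ∑ b, ∑ k, c a * d b * e k * B ![v a, v b, v k]
  have e0 : ∀ (p q r : Coord n), ![p, q, r] = Function.update ![0, q, r] 0 p := by
    intro p q r; ext i; fin_cases i <;> rfl
  have e1 : ∀ (p q r : Coord n), ![p, q, r] = Function.update ![p, 0, r] 1 q := by
    intro p q r; ext i; fin_cases i <;> rfl
  have e2 : ∀ (p q r : Coord n), ![p, q, r] = Function.update ![p, q, 0] 2 r := by
    intro p q r; ext i; fin_cases i <;> rfl
  have s0 : ∀ q r, B ![∑ a, c a • v a, q, r] = ∑ a, c a * B ![v a, q, r] := fun q r => by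
    rw [e0, MultilinearMap.map_update_sum]
    exact Finset.sum_congr rfl fun a _ => by rw [MultilinearMap.map_update_smul, ← e0, smul_eq_mul]
  have s1 : ∀ p r, B ![p, ∑ a, d a • v a, r] = ∑ a, d a * B ![p, v a, r] := fun q r => by
    rw [e1, MultilinearMap.map_update_sum]
    exact Finset.sum_congr rfl fun a _ => by rw [MultilinearMap.map_update_smul, ← e1, smul_eq_mul]
  have s2 : ∀ p q, B ![p, q, ∑ a, e a • v a] = ∑ a, e a * B ![p, q, v a] := fun q r => by
    rw [e2, MultilinearMap.map_update_sum]
    exact Finset.sum_congr rfl fun a _ => by rw [MultilinearMap.map_update_smul, ← e2, smul_eq_mul]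
  simp only [s0, s1, s2, Finset.mul_sum]
  exact Finset.sum_congr rfl fun _ _ => Finset.sum_congr rfl fun _ _ =>
    Finset.sum_congr rfl fun _ _ => by ring

lemma components_apply (T : ThreeForm n M) (φ : OpenPartialHomeomorph M (Coord n)) (i j k : Fin n)
    (y : Coord n) : components T φ i j k y = formAt T (φ.symm y)
      ![chartDiff φ y (basisVec i), chartDiff φ y (basisVec j), chartDiff φ y (basisVec k)] := by
  unfold components localForm formAt
  refine congrArg (T (φ.symm y)) ?_
  funext a
  fin_cases a <;> rfl

lemma IsSmooth.components {T : ThreeForm n M} (hT : IsSmooth T) (hφ : IsChart φ) (i j k : Fin n) :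
    ContDiffOn ℝ ∞ (components T φ i j k) φ.target :=
  (ContinuousAlternatingMap.apply ℝ (Coord n) ℝ
    ![basisVec i, basisVec j, basisVec k]).contDiff.comp_contDiffOn (hT φ hφ)

lemma isAlternating_components (T : ThreeForm n M) (φ : OpenPartialHomeomorph M (Coord n)) :
    IsAlternating (components T φ) where
  swap_left i j k z := by
    unfold components
    refine Eq.trans ?_ ((localForm T φ z).toAlternatingMap.map_swap
      ![basisVec j, basisVec i, basisVec k] (i := 0) (j := 1) (by decide))
    refine congrArg (localForm T φ z) ?_
    funext a
    fin_cases a <;> rfl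
  swap_right i j k z := by
    unfold components
    refine Eq.trans ?_ ((localForm T φ z).toAlternatingMap.map_swap
      ![basisVec i, basisVec k, basisVec j] (i := 1) (j := 2) (by decide))
    refine congrArg (localForm T φ z) ?_
    funext a
    fin_cases a <;> rfl

lemma IsClosedForm.isClosedAt {T : ThreeForm n M} (h : IsClosedForm T) (hT : IsSmooth T)
    (hφ : IsChart φ) (hy : y ∈ φ.target) : IsClosedAt (components T φ) y := by
  intro i j a b
  have hd : DifferentiableAt ℝ (localForm T φ) y :=
    ((hT φ hφ).contDiffAt (φ.open_target.mem_nhds hy)).differentiableAt (by simp)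
  have h1 := extDeriv_apply hd ![basisVec i, basisVec j, basisVec a, basisVec b]
  rw [h φ hφ y hy, Fin.sum_univ_four] at h1
  have r0 : (0 : Fin 4).removeNth (α := fun _ => Coord n)
      ![basisVec i, basisVec j, basisVec a, basisVec b] = ![basisVec j, basisVec a, basisVec b] := by
    funext k; fin_cases k <;> rfl
  have r1 : (1 : Fin 4).removeNth (α := fun _ => Coord n)
      ![basisVec i, basisVec j, basisVec a, basisVec b] = ![basisVec i, basisVec a, basisVec b] := by
    funext k; fin_cases k <;> rfl
  have r2 : (2 : Fin 4).removeNth (α := fun _ => Coord n)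
      ![basisVec i, basisVec j, basisVec a, basisVec b] = ![basisVec i, basisVec j, basisVec b] := by
    funext k; fin_cases k <;> rfl
  have r3 : (3 : Fin 4).removeNth (α := fun _ => Coord n)
      ![basisVec i, basisVec j, basisVec a, basisVec b] = ![basisVec i, basisVec j, basisVec a] := by
    funext k; fin_cases k <;> rfl
  rw [r0, r1, r2, r3] at h1
  have h2 : (0 : ℝ) = (-1) ^ 0 • pd i (components T φ j a b) y
      + (-1) ^ 1 • pd j (components T φ i a b) y + (-1) ^ 2 • pd a (components T φ i j b) y
      + (-1) ^ 3 • pd b (components T φ i j a) y := h1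
  norm_num at h2
  linarith

lemma contDiffOn_comp_symm {f : M → ℝ} (hf : ContMDiff (𝓡 n) 𝓘(ℝ, ℝ) ∞ f) (hφ : IsChart φ) :
    ContDiffOn ℝ ∞ (f ∘ φ.symm) φ.target := by
  rw [← contMDiffOn_iff_contDiffOn]
  exact hf.comp_contMDiffOn hφ.contMDiffOn_symm

lemma IsChart.mdifferentiableAt (hφ : IsChart φ) {x : M} (hx : x ∈ φ.source) :
    MDifferentiableAt (𝓡 n) (𝓡 n) φ x :=
  (hφ.contMDiffOn.contMDiffAt (φ.open_source.mem_nhds hx)).mdifferentiableAt (by simp)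

lemma IsChart.mdifferentiableAt_symm (hφ : IsChart φ) (hy : y ∈ φ.target) :
    MDifferentiableAt (𝓡 n) (𝓡 n) φ.symm y :=
  (hφ.contMDiffOn_symm.contMDiffAt (φ.open_target.mem_nhds hy)).mdifferentiableAt (by simp)

lemma IsChart.contDiffOn_transition (hφ : IsChart φ) (hφ' : IsChart φ') :
    ContDiffOn ℝ ∞ (fun z => φ (φ'.symm z)) (overlap φ φ') := by
  rw [← contMDiffOn_iff_contDiffOn]
  exact hφ.contMDiffOn.comp (hφ'.contMDiffOn_symm.mono Set.inter_subset_left) fun z hz => hz.2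

/-- Chain rule for `φ'⁻¹ = φ⁻¹ ∘ (φ ∘ φ'⁻¹)` near `z`. The equality is stated in `Coord n` because
the two base points are not definitionally equal. -/
lemma IsChart.chartDiff_transition (hφ : IsChart φ) (hφ' : IsChart φ') (hz : z ∈ overlap φ φ')
    (v : Coord n) : @Eq (Coord n) (chartDiff φ' z v)
      (chartDiff φ (φ (φ'.symm z)) (fderiv ℝ (fun z => φ (φ'.symm z)) z v)) := by
  have hd : DifferentiableAt ℝ (fun z => φ (φ'.symm z)) z :=
    ((hφ.contDiffOn_transition hφ').contDiffAt ((isOpen_overlap φ φ').mem_nhds hz)).differentiableAt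
      (by simp)
  have hev : φ'.symm =ᶠ[𝓝 z] φ.symm ∘ fun z => φ (φ'.symm z) := by
    filter_upwards [(isOpen_overlap φ φ').mem_nhds hz] with w hw
    exact (φ.left_inv hw.2).symm
  have hc := mfderiv_comp z (I := 𝓡 n) (I' := 𝓡 n) (I'' := 𝓡 n) (g := φ.symm)
    (f := fun z => φ (φ'.symm z)) (hφ.mdifferentiableAt_symm (φ.map_source hz.2))
    hd.mdifferentiableAt
  unfold chartDiff
  rw [hev.mfderiv_eq, hc, mfderiv_eq_fderiv]
  rfl

/-- The chart differential, as a linear map of the model space. -/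
def chartDiff' (φ : OpenPartialHomeomorph M (Coord n)) (y : Coord n) : Coord n →L[ℝ] Coord n :=
  chartDiff φ y

lemma IsChart.chartDiff_basisVec (hφ : IsChart φ) (hφ' : IsChart φ') (hz : z ∈ overlap φ φ')
    (i : Fin n) : @Eq (Coord n) (chartDiff φ' z (basisVec i))
      (∑ a, jacobian (fun z => φ (φ'.symm z)) a i z •
        chartDiff' φ (φ (φ'.symm z)) (basisVec a)) := by
  have hd : DifferentiableAt ℝ (fun z => φ (φ'.symm z)) z :=
    ((hφ.contDiffOn_transition hφ').contDiffAt ((isOpen_overlap φ φ').mem_nhds hz)).differentiableAt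
      (by simp)
  rw [hφ.chartDiff_transition hφ' hz, fderiv_basisVec hd]
  change chartDiff' φ _ _ = _
  simp only [map_sum, map_smul]

lemma IsChart.chartDiff_injective (hφ : IsChart φ) (hy : y ∈ φ.target) :
    Function.Injective (chartDiff φ y) := by
  have hev : φ ∘ φ.symm =ᶠ[𝓝 y] id := by
    filter_upwards [φ.open_target.mem_nhds hy] with w hw using φ.right_inv hw
  have hc := mfderiv_comp y (I := 𝓡 n) (I' := 𝓡 n) (I'' := 𝓡 n) (g := φ) (f := φ.symm)
    (hφ.mdifferentiableAt (φ.map_target hy)) (hφ.mdifferentiableAt_symm hy)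
  rw [hev.mfderiv_eq, mfderiv_id] at hc
  intro v w hvw
  have h := fun v => congrArg (fun L => L v) hc
  have hv := h v
  have hw := h w
  change v = mfderiv (𝓡 n) (𝓡 n) φ (φ.symm y) (chartDiff φ y v) at hv
  change w = mfderiv (𝓡 n) (𝓡 n) φ (φ.symm y) (chartDiff φ y w) at hw
  rw [hv, hw, hvw]

lemma IsChart.components_transition (hφ : IsChart φ) (hφ' : IsChart φ') (T : ThreeForm n M)
    (hz : z ∈ overlap φ φ') (i j k : Fin n) : components T φ' i j k z =
      ∑ a, ∑ b, ∑ c, jacobian (fun z => φ (φ'.symm z)) a i z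
        * jacobian (fun z => φ (φ'.symm z)) b j z * jacobian (fun z => φ (φ'.symm z)) c k z
        * components T φ a b c (φ (φ'.symm z)) := by
  rw [components_apply, hφ.chartDiff_basisVec hφ' hz, hφ.chartDiff_basisVec hφ' hz,
    hφ.chartDiff_basisVec hφ' hz, formAt_sum_smul]
  simp only [components_apply, φ.left_inv hz.2]
  rfl

variable [IsManifold (𝓡 n) ∞ M]

lemma isChart_chartAt (x : M) : IsChart (chartAt (Coord n) x) :=
  IsManifold.chart_mem_maximalAtlas x

/-- A metric at a point, as a function on the model space. -/
def innerAt (g : Metric n M) (x : M) (v w : Coord n) : ℝ := g.inner x v w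

lemma innerAt_sum_smul (g : Metric n M) (x : M) (c d : Fin n → ℝ) (v w : Fin n → Coord n) :
    innerAt g x (∑ a, c a • v a) (∑ b, d b • w b)
      = ∑ a, ∑ b, c a * d b * innerAt g x (v a) (w b) := by
  let B : Coord n →L[ℝ] Coord n →L[ℝ] ℝ := g.inner x
  change B _ _ = ∑ a, ∑ b, c a * d b * B (v a) (w b)
  simp [Finset.mul_sum, mul_assoc]
  rw [Finset.sum_comm]
  exact Finset.sum_congr rfl fun _ _ => Finset.sum_congr rfl fun _ _ => by ring

lemma localMetric_apply (g : Metric n M) (φ : OpenPartialHomeomorph M (Coord n)) (y : Coord n)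
    (i j : Fin n) : localMetric g φ y i j
      = innerAt g (φ.symm y) (chartDiff φ y (basisVec i)) (chartDiff φ y (basisVec j)) := rfl

lemma IsChart.localMetric_transition (hφ : IsChart φ) (hφ' : IsChart φ') (g : Metric n M)
    (hz : z ∈ overlap φ φ') (i j : Fin n) : localMetric g φ' z i j =
      ∑ a, ∑ b, jacobian (fun z => φ (φ'.symm z)) a i z * jacobian (fun z => φ (φ'.symm z)) b j z
        * localMetric g φ (φ (φ'.symm z)) a b := by
  rw [localMetric_apply, hφ.chartDiff_basisVec hφ' hz, hφ.chartDiff_basisVec hφ' hz,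
    innerAt_sum_smul]
  simp only [localMetric_apply, φ.left_inv hz.2]
  rfl

lemma IsChart.posDef_localMetric (hφ : IsChart φ) (g : Metric n M) (hy : y ∈ φ.target) :
    (localMetric g φ y).PosDef := by
  rw [Matrix.posDef_iff_dotProduct_mulVec]
  refine ⟨?_, fun v hv => ?_⟩
  · ext i j
    exact g.symm _ _ _
  · have h0 : (chartDiff' φ y (∑ i, v i • basisVec i)) ≠ 0 := by
      intro h
      have h1 : (∑ i, v i • basisVec i : Coord n) = 0 :=
        hφ.chartDiff_injective hy (h.trans (map_zero (chartDiff' φ y)).symm)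
      refine hv (funext fun j => ?_)
      have := congrArg (fun w : Coord n => w j) h1
      simpa [basisVec, Pi.single_apply] using this
    have h2 : 0 < innerAt g (φ.symm y) (chartDiff' φ y (∑ i, v i • basisVec i))
        (chartDiff' φ y (∑ i, v i • basisVec i)) := g.pos _ _ h0
    simp only [map_sum, map_smul, innerAt_sum_smul] at h2
    refine h2.trans_eq ?_
    simp only [dotProduct, Matrix.mulVec, star_trivial, Finset.mul_sum]
    exact Finset.sum_congr rfl fun i _ => Finset.sum_congr rfl fun j _ => by
      rw [localMetric_apply]
      change _ * innerAt g (φ.symm y) (chartDiff φ y (basisVec i)) (chartDiff φ y (basisVec j)) = _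
      ring

/-- The field is the tangent map of `φ.symm` applied to a constant field, and tangent maps of smooth
maps are smooth. -/
lemma IsChart.contMDiffOn_chartDiff (hφ : IsChart φ) (v : Coord n) :
    ContMDiffOn (𝓡 n) (𝓡 n).tangent ∞
      (fun y => (⟨φ.symm y, chartDiff φ y v⟩ : TangentBundle (𝓡 n) M)) φ.target := by
  have h1 : ContMDiffOn (𝓡 n) (𝓡 n).tangent ∞
      (fun y : Coord n => (⟨y, v⟩ : TangentBundle (𝓡 n) (Coord n))) φ.target := by
    intro y _
    exact contMDiffWithinAt_vectorSpace_iff_contDiffWithinAt.2 contDiffWithinAt_const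
  have hT := hφ.contMDiffOn_symm.contMDiffOn_tangentMapWithin (m := ∞) (by simp)
    φ.open_target.uniqueMDiffOn
  refine (hT.comp h1 fun y hy => hy).congr fun y hy => ?_
  simp only [Function.comp, tangentMapWithin, mfderivWithin_of_isOpen φ.open_target hy]
  rfl

lemma IsChart.metricOn (hφ : IsChart φ) (g : Metric n M) : MetricOn (localMetric g φ) φ.target where
  isOpen := φ.open_target
  posDef _ hz := hφ.posDef_localMetric g hz
  smooth i j := by
    rw [← contMDiffOn_iff_contDiffOn]
    intro y hy
    have : ContMDiffWithinAt (𝓡 n) ((𝓡 n).prod 𝓘(ℝ)) ∞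
        (fun y ↦ Bundle.TotalSpace.mk' ℝ (E := Bundle.Trivial M ℝ) (φ.symm y)
          (g.inner (φ.symm y) (chartDiff φ y (basisVec i)) (chartDiff φ y (basisVec j))))
        φ.target y := by
      apply ContMDiffWithinAt.clm_bundle_apply₂ (F₁ := Coord n) (F₂ := Coord n)
      · exact ContMDiffAt.comp_contMDiffWithinAt y g.contMDiff.contMDiffAt
          (hφ.contMDiffOn_symm y hy)
      · exact hφ.contMDiffOn_chartDiff (basisVec i) y hy
      · exact hφ.contMDiffOn_chartDiff (basisVec j) y hy
    simp only [Bundle.contMDiffWithinAt_totalSpace] at this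
    exact this.2

/-- Changes of charts are isometries between the local metrics. -/
lemma IsChart.isIsometryOn (hφ : IsChart φ) (hφ' : IsChart φ') (g : Metric n M) :
    IsIsometryOn (fun z => φ (φ'.symm z)) (localMetric g φ') (overlap φ φ')
      (localMetric g φ) φ.target where
  source :=
    { isOpen := isOpen_overlap φ φ'
      smooth := fun i j => ((hφ'.metricOn g).smooth i j).mono Set.inter_subset_left
      posDef := fun _ hz => (hφ'.metricOn g).posDef _ hz.1 }
  target := hφ.metricOn g
  smooth a := (contDiff_coord a).comp_contDiffOn (hφ.contDiffOn_transition hφ')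
  mapsTo _ hz := φ.map_source hz.2
  metric_eq _ hz i j := hφ.localMetric_transition hφ' g hz i j

end Charts

/-! ### Normal coordinates -/

section NormalCoordinates

/-- A quadratic change of coordinates with prescribed derivatives at the origin. -/
def quadraticMap (y₀ : Coord n) (P : Matrix (Fin n) (Fin n) ℝ) (Γ : Fin n → Fin n → Fin n → ℝ)
    (z : Coord n) : Coord n :=
  WithLp.toLp 2 fun a => y₀ a + ∑ i, P a i * z i
    - ∑ i, ∑ j, (1 / 2) * Γ a i j * (z i * z j)

variable {y₀ z : Coord n} {P : Matrix (Fin n) (Fin n) ℝ} {Γ : Fin n → Fin n → Fin n → ℝ}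

lemma contDiff_quadraticMap_apply (a : Fin n) :
    ContDiff ℝ ∞ fun z => quadraticMap y₀ P Γ z a := by
  have := fun k : Fin n => contDiff_coord k
  unfold quadraticMap
  simp only
  fun_prop

lemma contDiff_quadraticMap : ContDiff ℝ ∞ (quadraticMap y₀ P Γ) :=
  contDiff_euclidean.2 contDiff_quadraticMap_apply

lemma jacobian_quadraticMap (hΓ : ∀ a i j, Γ a i j = Γ a j i) (a i : Fin n) :
    jacobian (quadraticMap y₀ P Γ) a i z = P a i - ∑ j, Γ a i j * z j := by
  have d : ∀ k : Fin n, DifferentiableAt ℝ (fun z : Coord n => z k) z := fun k =>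
    (contDiff_coord k).differentiable (by simp) z
  have d1 : ∀ k, DifferentiableAt ℝ (fun z : Coord n => P a k * z k) z := fun k => (d k).const_mul _
  have d2 : ∀ k l, DifferentiableAt ℝ (fun z : Coord n => (1 / 2) * Γ a k l * (z k * z l)) z :=
    fun k l => ((d k).fun_mul (d l)).const_mul _
  change pd i (fun z => y₀ a + ∑ i, P a i * z i - ∑ i, ∑ j, (1 / 2) * Γ a i j * (z i * z j)) z = _
  rw [pd_sub ((differentiableAt_const _).fun_add (DifferentiableAt.fun_sum fun k _ => d1 k))
      (DifferentiableAt.fun_sum fun k _ => DifferentiableAt.fun_sum fun l _ => d2 k l),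
    pd_add (differentiableAt_const _) (DifferentiableAt.fun_sum fun k _ => d1 k), pd_const, zero_add,
    pd_sum _ d1, pd_sum _ fun k => DifferentiableAt.fun_sum fun l _ => d2 k l]
  simp only [fun k => pd_sum Finset.univ (d2 k) i, fun k => pd_const_mul (d k) (P a k) i,
    fun k l => pd_const_mul ((d k).fun_mul (d l)) (1 / 2 * Γ a k l) i,
    fun k l => pd_mul (d k) (d l) i, pd_coord, mul_add, Finset.sum_add_distrib]
  simp only [ite_mul, one_mul, zero_mul, mul_ite, mul_one, mul_zero, Finset.sum_ite_eq',
    Finset.mem_univ, if_true]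
  congr 1
  rw [Finset.sum_comm]
  simp only [Finset.sum_ite_eq', Finset.mem_univ, if_true]
  rw [← Finset.sum_add_distrib]
  exact Finset.sum_congr rfl fun j _ => by rw [hΓ a j i]; ring

lemma pd_jacobian_quadraticMap (hΓ : ∀ a i j, Γ a i j = Γ a j i) (a i j : Fin n) :
    pd i (jacobian (quadraticMap y₀ P Γ) a j) z = - Γ a i j := by
  have d : ∀ k : Fin n, DifferentiableAt ℝ (fun z : Coord n => z k) z := fun k =>
    (contDiff_coord k).differentiable (by simp) z
  rw [show jacobian (quadraticMap y₀ P Γ) a j = fun z => P a j - ∑ k, Γ a j k * z k from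
    funext fun z => jacobian_quadraticMap hΓ a j,
    pd_sub (differentiableAt_const _) (DifferentiableAt.fun_sum fun k _ => (d k).const_mul _),
    pd_const, pd_sum _ fun k => (d k).const_mul _]
  simp only [fun k => pd_const_mul (d k) (Γ a j k) i, pd_coord]
  simp [hΓ a i j]

lemma exists_equiv_of_det_jacobian_ne_zero {ψ : Coord n → Coord n} (hψ : DifferentiableAt ℝ ψ z)
    (h : (Matrix.of fun a i => jacobian ψ a i z).det ≠ 0) :
    ∃ L : Coord n ≃L[ℝ] Coord n, HasFDerivAt ψ (L : Coord n →L[ℝ] Coord n) z := by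
  have hinj : Function.Injective (fderiv ℝ ψ z).toLinearMap := by
    rw [← LinearMap.ker_eq_bot, LinearMap.ker_eq_bot']
    intro v hv
    have hv' : fderiv ℝ ψ z v = 0 := hv
    have h0 : Matrix.mulVec (Matrix.of fun a i => jacobian ψ a i z) (fun i => v i) = 0 := by
      funext a
      have e := fderiv_eq_sum_pd (fun w => ψ w a) z v
      have hc := ((EuclideanSpace.proj (𝕜 := ℝ) a).hasFDerivAt.comp z hψ.hasFDerivAt).fderiv
      rw [show (fun w => ψ w a) = (EuclideanSpace.proj (𝕜 := ℝ) a) ∘ ψ from rfl, hc] at e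
      simp only [ContinuousLinearMap.comp_apply, hv', map_zero] at e
      simp only [Matrix.mulVec, dotProduct, Matrix.of_apply, Pi.zero_apply]
      rw [e]
      exact Finset.sum_congr rfl fun i _ => mul_comm _ _
    have h1 := Matrix.eq_zero_of_mulVec_eq_zero h h0
    ext i
    exact congrFun h1 i
  refine ⟨(LinearEquiv.ofInjectiveEndo _ hinj).toContinuousLinearEquiv, ?_⟩
  convert hψ.hasFDerivAt using 1
  ext v : 1
  rfl

/-- A smooth map with invertible derivative at `z` restricts to a diffeomorphism near `z`. -/
lemma exists_openPartialHomeomorph {ψ : Coord n → Coord n} (hψ : ContDiff ℝ ∞ ψ)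
    (h : (Matrix.of fun a i => jacobian ψ a i z).det ≠ 0) :
    ∃ e : OpenPartialHomeomorph (Coord n) (Coord n), z ∈ e.source ∧ (e : Coord n → Coord n) = ψ ∧
      ContDiffOn ℝ ∞ e.symm e.target := by
  have hd : ∀ w, DifferentiableAt ℝ ψ w := fun w => hψ.differentiable (by simp) w
  obtain ⟨L, hL⟩ := exists_equiv_of_det_jacobian_ne_zero (hd z) h
  set e₀ := hψ.contDiffAt.toOpenPartialHomeomorph ψ hL (by simp) with he₀
  -- The inverse is smooth at the image of any point where the Jacobian is invertible; restriction
  -- to this open set makes it smooth on the whole target.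
  have hU : IsOpen {w | (Matrix.of fun a i => jacobian ψ a i w).det ≠ 0} := by
    refine isOpen_ne_fun ?_ continuous_const
    rw [← continuousOn_univ]
    exact (MetricOn.smooth_det fun a i => contDiffOn_pd isOpen_univ
      (contDiff_euclidean.1 hψ a).contDiffOn i).continuousOn
  refine ⟨e₀.restrOpen _ hU, ⟨hψ.contDiffAt.mem_toOpenPartialHomeomorph_source hL (by simp), h⟩,
    rfl, fun w hw => ?_⟩
  have hw' : (e₀.restrOpen _ hU).symm w ∈ (e₀.restrOpen _ hU).source :=
    (e₀.restrOpen _ hU).map_target hw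
  obtain ⟨L', hL'⟩ := exists_equiv_of_det_jacobian_ne_zero (hd _) hw'.2
  exact ((e₀.restrOpen _ hU).contDiffAt_symm hw hL' hψ.contDiffAt).contDiffWithinAt

variable {M : Type*} [TopologicalSpace M] [ChartedSpace (Coord n) M] [IsManifold (𝓡 n) ∞ M]
  {φ : OpenPartialHomeomorph M (Coord n)} {y : Coord n}

/-- Charts which are normal to first order at a given point exist. -/
theorem IsChart.exists_normal (hφ : IsChart φ) (g : Metric n M) (hy : y ∈ φ.target) :
    ∃ φ' : OpenPartialHomeomorph M (Coord n), IsChart φ' ∧ ∃ z ∈ overlap φ φ',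
      φ (φ'.symm z) = y ∧ IsNormalAt (localMetric g φ') z := by
  have hG := hφ.metricOn g
  obtain ⟨B, hB⟩ := exists_eq_transpose_mul_self (hG.posDef y hy).posSemidef
  have hBu : IsUnit B.det := by
    have := hG.isUnit_det hy
    rw [hB, Matrix.det_mul] at this
    exact isUnit_of_mul_isUnit_right this
  -- As `G y = Bᵀ B`, the linear part `P` makes the metric the identity at the new origin. `Γ` below
  -- is `Γ^e_{ab}` with its lower indices pulled back by `P`, exactly the second order correction
  -- required by `IsIsometryOn.isNormalAt`.
  set P := B⁻¹ with hP
  set Γ : Fin n → Fin n → Fin n → ℝ := fun e i j =>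
    ∑ a, ∑ b, P a i * P b j * christoffel (localMetric g φ) e a b y with hΓdef
  have hΓ : ∀ e i j, Γ e i j = Γ e j i := fun e i j => by
    simp only [hΓdef]
    rw [Finset.sum_comm]
    refine Finset.sum_congr rfl fun a _ => Finset.sum_congr rfl fun b _ => ?_
    rw [hG.christoffel_symm hy e a b]
    ring
  set ψ := quadraticMap y P Γ with hψ
  have hψ0 : ψ 0 = y := by
    ext a
    simp [hψ, quadraticMap]
  have hJ0 : ∀ a i, jacobian ψ a i 0 = P a i := fun a i => by
    rw [hψ, jacobian_quadraticMap hΓ]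
    simp
  have hPu : IsUnit P.det := by
    rw [hP, Matrix.det_nonsing_inv]
    exact hBu.ringInverse
  obtain ⟨e, h0, heψ, hes⟩ := exists_openPartialHomeomorph (z := 0)
    (contDiff_quadraticMap (y₀ := y) (P := P) (Γ := Γ)) (by
      have : (Matrix.of fun a i => jacobian (quadraticMap y P Γ) a i 0) = P := by
        ext a i
        exact hJ0 a i
      rw [this]
      exact hPu.ne_zero)
  -- The map `e` goes from new coordinates to old ones, so the new chart is `φ` followed by the
  -- inverse of `e`.
  have hechart : IsChart (φ.trans e.symm) := by
    refine OpenPartialHomeomorph.mem_maximalAtlas_of_contMDiffOn _ ?_ ?_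
    · exact (contMDiffOn_iff_contDiffOn.2 hes).comp
        (hφ.contMDiffOn.mono fun x hx => by simp at hx; exact hx.1) fun x hx => by
          simp at hx; exact hx.2
    · refine hφ.contMDiffOn_symm.comp (t := φ.target)
        ((contMDiffOn_iff_contDiffOn (f := e) (s := e.source)).2
          (by rw [heψ]; exact contDiff_quadraticMap.contDiffOn) |>.mono fun x hx => by
            simp at hx; exact hx.1) fun x hx => by simp at hx; exact hx.2
  have he : ∀ z, (φ.trans e.symm).symm z = φ.symm (ψ z) := fun z => by
    simp [heψ, hψ]
  have hov : ∀ z ∈ overlap φ (φ.trans e.symm), φ ((φ.trans e.symm).symm z) = ψ z := by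
    rintro z ⟨hz, -⟩
    rw [he]
    refine φ.right_inv ?_
    simp at hz
    have := hz.2
    rwa [heψ] at this
  have h0ov : (0 : Coord n) ∈ overlap φ (φ.trans e.symm) := by
    refine ⟨?_, ?_⟩
    · simp only [OpenPartialHomeomorph.trans_target, OpenPartialHomeomorph.symm_target,
        OpenPartialHomeomorph.symm_symm, Set.mem_inter_iff, Set.mem_preimage]
      refine ⟨h0, ?_⟩
      rw [heψ, ← hψ, hψ0]
      exact hy
    · rw [Set.mem_preimage, he, hψ0]
      exact φ.map_target hy
  have hiso := hφ.isIsometryOn hechart g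
  have hJ : ∀ a i, Set.EqOn (jacobian (fun z => φ ((φ.trans e.symm).symm z)) a i)
      (jacobian ψ a i) (overlap φ (φ.trans e.symm)) := fun a i z hz =>
    pd_congr (isOpen_overlap _ _) (fun w hw => by simp only [hov w hw]) hz i
  refine ⟨φ.trans e.symm, hechart, 0, h0ov, by rw [hov 0 h0ov, hψ0],
    hiso.isNormalAt h0ov ?_ fun a i j => ?_⟩
  · have h1 : P.transpose * localMetric g φ y * P = 1 := by
      rw [hB, ← Matrix.mul_assoc, ← Matrix.transpose_mul, hP, Matrix.mul_nonsing_inv _ hBu,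
        Matrix.transpose_one, Matrix.one_mul, Matrix.mul_nonsing_inv _ hBu]
    rw [← h1]
    ext i j
    rw [hiso.metric_eq 0 h0ov, Matrix.mul_apply, Finset.sum_comm]
    refine Finset.sum_congr rfl fun b _ => ?_
    rw [Matrix.mul_apply, Finset.sum_mul]
    refine Finset.sum_congr rfl fun a _ => ?_
    rw [hJ _ _ h0ov, hJ _ _ h0ov, hJ0, hJ0, hov 0 h0ov, hψ0, Matrix.transpose_apply]
    ring
  · rw [pd_congr (isOpen_overlap _ _) (hJ a j) h0ov, hψ, pd_jacobian_quadraticMap hΓ,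
      hov 0 h0ov, hψ0]
    simp only [hJ _ _ h0ov, hJ0, hΓdef]

end NormalCoordinates

/-! ### Gradient solitons -/

/-! ### The differential operators on constants, under sign change and at local maxima. -/

section Constancy

variable {G : Coord n → Matrix (Fin n) (Fin n) ℝ} {s : Set (Coord n)} {y : Coord n}
  {u v : Coord n → ℝ} {τ : Fin n → Fin n → Fin n → Coord n → ℝ}

lemma laplacian_congr (hs : IsOpen s) (h : Set.EqOn u v s) (hy : y ∈ s) :
    laplacian G u y = laplacian G v y := by
  have h1 : ∀ i, Set.EqOn (pd i u) (pd i v) s := fun i z hz => pd_congr hs h hz i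
  simp only [laplacian, hessian, fun i => h1 i hy, fun i j => pd_congr hs (h1 j) hy i]

lemma gradSq_congr (hs : IsOpen s) (h : Set.EqOn u v s) (hy : y ∈ s) :
    gradSq G u y = gradSq G v y := by
  simp only [gradSq, fun i => pd_congr hs h hy i]

lemma hessian_const (c : ℝ) (i j : Fin n) : hessian G (fun _ => c) i j y = 0 := by
  have : pd j (fun _ : Coord n => c) = fun _ => 0 := funext fun z => pd_const j c
  simp [hessian, this, pd_const]

lemma laplacian_const (c : ℝ) : laplacian G (fun _ => c) y = 0 := by
  simp [laplacian, hessian_const]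

lemma gradSq_const (c : ℝ) : gradSq G (fun _ => c) y = 0 := by
  simp [gradSq, pd_const]

lemma gradInterior_const (c : ℝ) (i j : Fin n) : gradInterior G τ (fun _ => c) i j y = 0 := by
  simp [gradInterior, pd_const]

lemma laplacian_neg : laplacian G (fun z => - u z) y = - laplacian G u y := by
  have h1 : ∀ i, pd i (fun z => - u z) = fun z => - pd i u z := fun i => funext fun z => pd_neg i
  have h2 : ∀ i j, hessian G (fun z => - u z) i j y = - hessian G u i j y := fun i j => by
    unfold hessian
    simp only [h1, pd_neg, mul_neg, Finset.sum_neg_distrib]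
    ring
  simp only [laplacian, h2, mul_neg, Finset.sum_neg_distrib]

lemma gradSq_neg : gradSq G (fun z => - u z) y = gradSq G u y := by
  simp only [gradSq, pd_neg, neg_mul_neg]

lemma MetricOn.smooth_solitonPotential (hG : MetricOn G s) (hu : ContDiffOn ℝ ∞ u s)
    (hτ : ∀ i j k, ContDiffOn ℝ ∞ (τ i j k) s) :
    ContDiffOn ℝ ∞ (solitonPotential G τ u) s :=
  ((hG.smooth_laplacian hu).sub (hG.smooth_gradSq hu)).add
    (contDiffOn_const.mul (hG.smooth_normSq hτ))

lemma MetricOn.gradSq_eq_zero_of_isLocalMax (h : IsLocalMax u y) : gradSq G u y = 0 := by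
  simp [gradSq, pd_eq_zero_of_isLocalMax h]

lemma MetricOn.laplacian_nonpos_of_isLocalMax (hG : MetricOn G s) (hu : ContDiffOn ℝ ∞ u s)
    (hy : y ∈ s) (h : IsLocalMax u y) : laplacian G u y ≤ 0 := by
  have h1 := ellipticOp_nonpos (A := fun z => (G z)⁻¹) (b := fun _ _ => 0) hG.isOpen hu hy h
    (hG.posDef y hy).inv.posSemidef
  simpa [ellipticOp, laplacian, hessian, pd_eq_zero_of_isLocalMax h] using h1

end Constancy

/-! ### The conserved quantity on the manifold and constancy of solutions. -/

section Soliton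

variable {M : Type*} [TopologicalSpace M] [ChartedSpace (Coord n) M] [IsManifold (𝓡 n) ∞ M]
  {g : Metric n M} {T : ThreeForm n M} {f : M → ℝ} {φ φ' : OpenPartialHomeomorph M (Coord n)}
  {y z : Coord n}

/-- The function `Δf - |∇f|² + ⅙ ‖T‖²` in a chart. -/
def localPotential (g : Metric n M) (T : ThreeForm n M) (f : M → ℝ)
    (φ : OpenPartialHomeomorph M (Coord n)) : Coord n → ℝ :=
  solitonPotential (localMetric g φ) (components T φ) (f ∘ φ.symm)

lemma IsChart.localPotential_transition (hφ : IsChart φ) (hφ' : IsChart φ')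
    (hf : ContMDiff (𝓡 n) 𝓘(ℝ, ℝ) ∞ f) (hz : z ∈ overlap φ φ') :
    localPotential g T f φ' z = localPotential g T f φ (φ (φ'.symm z)) := by
  have hiso := hφ.isIsometryOn hφ' g
  have hcong : Set.EqOn (f ∘ φ'.symm) (fun w => (f ∘ φ.symm) (φ (φ'.symm w))) (overlap φ φ') :=
    fun w hw => by simp [φ.left_inv hw.2]
  unfold localPotential
  rw [← hiso.solitonPotential_comp hz (contDiffOn_comp_symm hf hφ)
    (fun i j k => hφ.components_transition hφ' T hz i j k)]
  unfold solitonPotential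
  rw [laplacian_congr (isOpen_overlap φ φ') hcong hz, gradSq_congr (isOpen_overlap φ φ') hcong hz]

lemma IsChart.smooth_localPotential (hφ : IsChart φ) (g : Metric n M) (hT : IsSmooth T)
    (hf : ContMDiff (𝓡 n) 𝓘(ℝ, ℝ) ∞ f) : ContDiffOn ℝ ∞ (localPotential g T f φ) φ.target :=
  (hφ.metricOn g).smooth_solitonPotential (contDiffOn_comp_symm hf hφ) (hT.components hφ)

namespace IsGradientSoliton

/-- The differential vanishes in a chart normal at the given point; the chain rule for the
transition map brings this back to `φ`. -/
lemma pd_localPotential (hsol : IsGradientSoliton g T f) (hT : IsSmooth T)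
    (hf : ContMDiff (𝓡 n) 𝓘(ℝ, ℝ) ∞ f) (hφ : IsChart φ) (hy : y ∈ φ.target) (j : Fin n) :
    pd j (localPotential g T f φ) y = 0 := by
  obtain ⟨φ', hφ', z, hz, hzy, hN⟩ := hφ.exists_normal g hy
  have hzero : ∀ a, pd a (localPotential g T f φ') z = 0 :=
    hN.pd_solitonPotential (hφ'.metricOn g) hz.1 (contDiffOn_comp_symm hf hφ') (hT.components hφ')
      (isAlternating_components T φ') (hsol.closed.isClosedAt hT hφ' hz.1)
      (hsol.ricci_eq φ' hφ') (hsol.codiff_eq φ' hφ' z hz.1)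
  have hy' : y ∈ overlap φ' φ := hzy ▸ overlap_swap_mem hz
  have hback : φ' (φ.symm y) = z := by
    rw [← hzy, φ.left_inv hz.2, φ'.right_inv hz.1]
  rw [pd_congr (isOpen_overlap φ' φ)
    (fun w hw => hφ'.localPotential_transition hφ hf hw) hy',
    (hφ'.isIsometryOn hφ g).pd_comp hy' (hφ'.smooth_localPotential g hT hf)]
  simp [hback, hzero]

/-- `Δf - |∇f|² + ⅙ ‖T‖²` is constant on a gradient soliton. -/
theorem exists_localPotential_eq [ConnectedSpace M] (hsol : IsGradientSoliton g T f)
    (hT : IsSmooth T) (hf : ContMDiff (𝓡 n) 𝓘(ℝ, ℝ) ∞ f) :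
    ∃ c : ℝ, ∀ φ : OpenPartialHomeomorph M (Coord n), IsChart φ → ∀ y ∈ φ.target,
      localPotential g T f φ y = c := by
  -- A global function defined through the preferred charts; by invariance it represents the
  -- potential in every chart.
  set F : M → ℝ := fun x => localPotential g T f (chartAt (Coord n) x) (chartAt (Coord n) x x)
  have hF : ∀ φ : OpenPartialHomeomorph M (Coord n), IsChart φ → ∀ y ∈ φ.target,
      localPotential g T f φ y = F (φ.symm y) := fun φ hφ y hy =>
    (isChart_chartAt (φ.symm y)).localPotential_transition hφ hf
      ⟨hy, mem_chart_source (Coord n) (φ.symm y)⟩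
  have hloc : IsLocallyConstant F := by
    refine IsLocallyConstant.iff_eventually_eq F |>.2 fun x => ?_
    set φ := chartAt (Coord n) x with hφdef
    have hφ : IsChart φ := isChart_chartAt x
    have hx : x ∈ φ.source := mem_chart_source (Coord n) x
    obtain ⟨r, hr0, hr⟩ := Metric.isOpen_iff.1 φ.open_target (φ x) (φ.map_source hx)
    have hconst : ∀ w ∈ Metric.ball (φ x) r,
        localPotential g T f φ w = localPotential g T f φ (φ x) := fun w hw => by
      refine Metric.isOpen_ball.is_const_of_fderiv_eq_zero (𝕜 := ℝ)
        (convex_ball (φ x) r).isPreconnected ?_ ?_ hw (Metric.mem_ball_self hr0)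
      · exact ((hφ.smooth_localPotential g hT hf).mono hr).differentiableOn (by simp)
      · intro v hv
        ext d
        rw [fderiv_eq_sum_pd]
        simp [hsol.pd_localPotential hT hf hφ (hr hv)]
    filter_upwards [φ.continuousAt hx (Metric.ball_mem_nhds (φ x) hr0),
      φ.open_source.mem_nhds hx] with x' hx' hs'
    have := hconst (φ x') hx'
    rwa [hF φ hφ _ (φ.map_source hs'), hF φ hφ _ (φ.map_source hx), φ.left_inv hs',
      φ.left_inv hx] at this
  obtain ⟨x₀⟩ := (inferInstance : Nonempty M)
  exact ⟨F x₀, fun φ hφ y hy =>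
    (hF φ hφ y hy).trans (hloc.apply_eq_of_preconnectedSpace _ _)⟩

/-- The trace of the soliton equation. -/
lemma scalarCurvature_eq (hsol : IsGradientSoliton g T f) (hφ : IsChart φ) (hy : y ∈ φ.target) :
    scalarCurvature (localMetric g φ) y = (1 / 4) * normSq (localMetric g φ) (components T φ) y
      - laplacian (localMetric g φ) (f ∘ φ.symm) y := by
  unfold scalarCurvature normSq laplacian
  simp only [hsol.ricci_eq φ hφ y hy, Finset.mul_sum, ← Finset.sum_sub_distrib]
  exact Finset.sum_congr rfl fun i _ => Finset.sum_congr rfl fun j _ => by ring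

/-- The Ricci tensor of the torsion connection of a gradient soliton. -/
lemma ricci_torsionCoeff (hsol : IsGradientSoliton g T f) (hT : IsSmooth T) (hφ : IsChart φ)
    (hy : y ∈ φ.target) (i j : Fin n) :
    ricci (torsionCoeff (localMetric g φ) (components T φ)) i j y
      = (1 / 2) * gradInterior (localMetric g φ) (components T φ) (f ∘ φ.symm) i j y
        - hessian (localMetric g φ) (f ∘ φ.symm) i j y := by
  rw [(hφ.metricOn g).ricci_torsionCoeff hy (hT.components hφ) (isAlternating_components T φ),
    hsol.ricci_eq φ hφ y hy, hsol.codiff_eq φ hφ y hy]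
  ring

/-- Torsion Ricci flatness makes the Hessian a multiple of the skew tensor `grad f ⌟ T`, whose trace
is zero. -/
lemma laplacian_eq_zero (hsol : IsGradientSoliton g T f) (hT : IsSmooth T)
    (h : IsTorsionRicciFlat g T) (hφ : IsChart φ) (hy : y ∈ φ.target) :
    laplacian (localMetric g φ) (f ∘ φ.symm) y = 0 := by
  have h1 : ∀ i j, hessian (localMetric g φ) (f ∘ φ.symm) i j y
      = (1 / 2) * gradInterior (localMetric g φ) (components T φ) (f ∘ φ.symm) i j y :=
    fun i j => by
      have := h φ hφ y hy i j
      rw [hsol.ricci_torsionCoeff hT hφ hy] at this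
      linarith
  have h2 := (hφ.metricOn g).sum_inv_mul_gradInterior (u := f ∘ φ.symm) hy
    (isAlternating_components T φ)
  unfold laplacian
  simp only [h1, mul_left_comm _ (1 / 2 : ℝ), ← Finset.mul_sum, h2, mul_zero]

end IsGradientSoliton

/-- At a maximum the gradient term drops out whatever the sign of `β`, which allows a second
application to `-f`. -/
lemma nonpos_of_isMax (g : Metric n M) (hf : ContMDiff (𝓡 n) 𝓘(ℝ, ℝ) ∞ f) {α β k : ℝ}
    (hα : 0 < α) (heq : ∀ φ : OpenPartialHomeomorph M (Coord n), IsChart φ → ∀ y ∈ φ.target,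
      α * laplacian (localMetric g φ) (f ∘ φ.symm) y
        - β * gradSq (localMetric g φ) (f ∘ φ.symm) y = k)
    {x : M} (hmax : ∀ x', f x' ≤ f x) : k ≤ 0 := by
  have hφ : IsChart (chartAt (Coord n) x) := isChart_chartAt x
  have hx := mem_chart_source (Coord n) x
  have hloc := isLocalMax_comp_symm hx hmax
  have hy := (chartAt (Coord n) x).map_source hx
  have h1 := (hφ.metricOn g).laplacian_nonpos_of_isLocalMax (contDiffOn_comp_symm hf hφ) hy hloc
  rw [← heq _ hφ _ hy, MetricOn.gradSq_eq_zero_of_isLocalMax hloc]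
  nlinarith

/-- On a compact connected manifold a solution of `α Δf - β |∇f|² = k` with `α > 0` is constant. -/
theorem exists_eq_const [CompactSpace M] [ConnectedSpace M] (g : Metric n M)
    (hf : ContMDiff (𝓡 n) 𝓘(ℝ, ℝ) ∞ f) {α β k : ℝ} (hα : 0 < α)
    (heq : ∀ φ : OpenPartialHomeomorph M (Coord n), IsChart φ → ∀ y ∈ φ.target,
      α * laplacian (localMetric g φ) (f ∘ φ.symm) y
        - β * gradSq (localMetric g φ) (f ∘ φ.symm) y = k) : ∃ c : ℝ, ∀ x, f x = c := by
  have hcont : Continuous f := hf.continuous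
  obtain ⟨p, -, hp⟩ := isCompact_univ.exists_isMaxOn Set.univ_nonempty hcont.continuousOn
  obtain ⟨q, -, hq⟩ := isCompact_univ.exists_isMinOn Set.univ_nonempty hcont.continuousOn
  have hp' : ∀ x, f x ≤ f p := fun x => hp (Set.mem_univ x)
  have hq' : ∀ x, f q ≤ f x := fun x => hq (Set.mem_univ x)
  have hk1 : k ≤ 0 := nonpos_of_isMax g hf hα heq hp'
  -- The Laplacian is odd and `|∇f|²` is even in `f`, so `-f` solves the equation with `-β` and
  -- `-k`.
  have hk2 : -k ≤ 0 := by
    refine nonpos_of_isMax g (f := fun x => - f x) (β := -β) hf.neg hα (fun φ hφ y hy => ?_)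
      (x := q) fun x => neg_le_neg (hq' x)
    have h1 : (fun x => - f x) ∘ φ.symm = fun z => - (f ∘ φ.symm) z := rfl
    rw [h1, laplacian_neg, gradSq_neg, ← heq φ hφ y hy]
    ring
  have hk : k = 0 := by linarith
  have hclopen : IsClopen {x | f x = f p} := by
    refine ⟨isClosed_eq hcont continuous_const, isOpen_iff_mem_nhds.2 fun x hx => ?_⟩
    have hx : f x = f p := hx
    set φ := chartAt (Coord n) x
    have hφ : IsChart φ := isChart_chartAt x
    have hxs : x ∈ φ.source := mem_chart_source (Coord n) x
    have hval : (f ∘ φ.symm) (φ x) = f p := by simp [φ.left_inv hxs, hx]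
    have hev := (hφ.metricOn g).eventually_eq_of_isMax (contDiffOn_comp_symm hf hφ) hα
      (fun z hz => (heq φ hφ z hz).trans hk) (φ.map_source hxs)
      (fun z _ => by rw [hval]; exact hp' _)
    filter_upwards [φ.continuousAt hxs hev, φ.open_source.mem_nhds hxs] with x' h1 h2
    have h1 : (f ∘ φ.symm) (φ x') = (f ∘ φ.symm) (φ x) := h1
    rw [hval] at h1
    simpa [φ.left_inv h2] using h1
  have huniv := hclopen.eq_univ ⟨p, rfl⟩
  exact ⟨f p, fun x => (huniv ▸ Set.mem_univ x : x ∈ {x | f x = f p})⟩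

end Soliton

end SkewTorsion

end

/-! ### The equivalences and harmonicity. -/

theorem theorem1p1 {n : ℕ} {M : Type*} [TopologicalSpace M] [T2Space M] [CompactSpace M]
    [ConnectedSpace M] [ChartedSpace (EuclideanSpace ℝ (Fin n)) M] [IsManifold (𝓡 n) ∞ M]
    (g : SkewTorsion.Metric n M) (T : SkewTorsion.ThreeForm n M) (hT : SkewTorsion.IsSmooth T)
    (f : M → ℝ) (hf : ContMDiff (𝓡 n) 𝓘(ℝ, ℝ) ∞ f)
    (hsol : SkewTorsion.IsGradientSoliton g T f) :
    [SkewTorsion.HasConstantNorm g T,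
      ∃ c : ℝ, ∀ x, f x = c,
      SkewTorsion.IsTorsionRicciFlat g T,
      SkewTorsion.HasConstantScalarCurvature g].TFAE ∧
    ((SkewTorsion.HasConstantNorm g T ∨ (∃ c : ℝ, ∀ x, f x = c) ∨
      SkewTorsion.IsTorsionRicciFlat g T ∨ SkewTorsion.HasConstantScalarCurvature g) →
      SkewTorsion.IsHarmonic g T) := by
  open SkewTorsion in
  obtain ⟨l, hl⟩ := hsol.exists_localPotential_eq hT hf
  have hconst : ∀ {c : ℝ}, (∀ x, f x = c) →
      ∀ φ : OpenPartialHomeomorph M (Coord n), f ∘ φ.symm = fun _ => c :=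
    fun hc φ => funext fun _ => hc _
  have hab : HasConstantNorm g T → ∃ c : ℝ, ∀ x, f x = c := by
    rintro ⟨c, hc⟩
    refine exists_eq_const g hf (α := 1) (β := 1) (k := l - (1 / 6) * c) one_pos
      fun φ hφ y hy => ?_
    have h := hl φ hφ y hy
    rw [localPotential, solitonPotential, hc φ hφ y hy] at h
    linarith
  have hcb : IsTorsionRicciFlat g T → ∃ c : ℝ, ∀ x, f x = c := fun h =>
    exists_eq_const g hf (α := 1) (β := 0) (k := 0) one_pos fun φ hφ y hy => by
      rw [hsol.laplacian_eq_zero hT h hφ hy]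
      ring
  have hdb : HasConstantScalarCurvature g → ∃ c : ℝ, ∀ x, f x = c := by
    rintro ⟨c, hc⟩
    -- The trace gives `‖T‖² = 4 (c + Δf)`; in the conserved quantity this adds `⅔ Δf + ⅔ c`.
    refine exists_eq_const g hf (α := 5 / 3) (β := 1) (k := l - (2 / 3) * c) (by norm_num)
      fun φ hφ y hy => ?_
    have h := hl φ hφ y hy
    have h2 := hsol.scalarCurvature_eq hφ hy
    rw [hc φ hφ y hy] at h2
    rw [localPotential, solitonPotential] at h
    linarith
  have hba : (∃ c : ℝ, ∀ x, f x = c) → HasConstantNorm g T := by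
    rintro ⟨c, hc⟩
    refine ⟨6 * l, fun φ hφ y hy => ?_⟩
    have h := hl φ hφ y hy
    rw [localPotential, solitonPotential, hconst hc, laplacian_const, gradSq_const] at h
    linarith
  have hbc : (∃ c : ℝ, ∀ x, f x = c) → IsTorsionRicciFlat g T := by
    rintro ⟨c, hc⟩ φ hφ y hy i j
    rw [hsol.ricci_torsionCoeff hT hφ hy, hconst hc, gradInterior_const, hessian_const]
    ring
  have hbd : (∃ c : ℝ, ∀ x, f x = c) → HasConstantScalarCurvature g := by
    intro hb
    obtain ⟨k, hk⟩ := hba hb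
    obtain ⟨c, hc⟩ := hb
    refine ⟨(1 / 4) * k, fun φ hφ y hy => ?_⟩
    rw [hsol.scalarCurvature_eq hφ hy, hk φ hφ y hy, hconst hc, laplacian_const, sub_zero]
  have hharm : (∃ c : ℝ, ∀ x, f x = c) → IsHarmonic g T := by
    rintro ⟨c, hc⟩
    refine ⟨hsol.closed, fun φ hφ y hy i j => ?_⟩
    rw [hsol.codiff_eq φ hφ y hy, hconst hc, gradInterior_const, neg_zero]
  refine ⟨?_, ?_⟩
  · tfae_have 1 → 2 := hab
    tfae_have 2 → 1 := hba
    tfae_have 2 → 3 := hbc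
    tfae_have 3 → 2 := hcb
    tfae_have 2 → 4 := hbd
    tfae_have 4 → 2 := hdb
    tfae_finish
  · rintro (h | h | h | h)
    exacts [hharm (hab h), hharm h, hharm (hcb h), hharm (hdb h)]
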